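/- **Proposition 2 (Consistency of the target distribution).** *Model.* Let $X$ (states), $\Xi$ (designs), $\Theta$ (parameters) be measurable spaces, $dx$, $d\xi$ $\sigma$-finite measures on $X$, $\Xi$, $p(dx_0)$ and $p(d\theta)$ probability measures on $X$ and $\Theta$, $f(x'\mid x,\xi,\theta)$ a jointly measurable transition density with respect to $dx'$, and, for each $t$, $\pi(\xi_t\mid z_{0:t})$ a measurable policy density with respect to $d\xi_t$. Here $z_0=x_0$, $z_{s+1}=(x_{s+1},\xi_s)$, $dz_{s+1}=dx_{s+1}\,d\xi_s$. Put $$p(z_{s+1}\mid z_{0:s},\theta)=f(x_{s+1}\mid x_s,\xi_s,\theta)\,\pi(\xi_s\mid z_{0:s}),$$ let $p(\theta\mid z_{0:s})$ be the posterior of $\theta$ given by Bayes' rule, $p(z_{s+1}\mid z_{0:s})=\int p(z_{s+1}\mid z_{0:s},\theta)\,p(d\theta\mid z_{0:s})$ and $p(x_{s+1}\mid z_{0:s},\xi_s)=\int f(x_{s+1}\mid x_s,\xi_s,\theta)\,p(d\theta\mid z_{0:s})$. Let $\eta>0$ and, for $t\ge 0$, $$\Gamma(dz_{0:t},d\theta_t)=\frac1{Z_t}\,p(dz_0)\prod_{s=0}^{t-1}p(z_{s+1}\mid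 z_{0:s})\exp\{-\eta\log p(x_{s+1}\mid z_{0:s},\xi_s)\}\,dz_{s+1}\;p(d\theta_t\mid z_{0:t}),$$ with $Z_t$ the normalizing constant. *Algorithm.* For each $s\geq 1$ let $K_s$ be a Markov kernel on $\Theta$, depending measurably on $z_{0:s}$, which (for $1\le s\le t$) leaves $p(\theta\mid z_{0:s})$ invariant. For $M\ge1$ let $\Gamma_t^M(z_{0:t},\theta_{0:t}^{1:M},a_{1:t}^{1:M})$ be the probability distribution of all the variables of Inside-Out SMC$^2$ (with multinomial resampling at every IBIS step), i.e. the distribution proportional to $$p(dz_0)\prod_{m=1}^M p(d\theta_0^m)\prod_{s=0}^{t-1}\Big\{\Big[\tfrac1M\sum_{m=1}^M p(z_{s+1}\mid z_{0:s},\theta_s^m)\Big]\exp\Big\{-\eta\log\tfrac1M\sum_{m=1}^M f(x_{s+1}\mid x_s,\xi_s,\theta_s^m)\Big\}dz_{s+1}\prod_{m=1}^M W_{s+1}^{a_{s+1}^m}K_{s+1}(\theta_s^{a_{s+1}^m},d\theta_{s+1}^m)\Big\},$$ where $W_{s+1}^m=p(z_{s+1}\mid z_{0:s},\theta_s^m)/\sum_{j}p(z_{s+1}\mid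 z_{0:s},\theta_s^j)$. Let $\tilde\Gamma_t^M(dz_{0:t},d\theta_t)$ be the expected empirical distribution, that is, the expectation under $\Gamma_t^M$ of the random measure $\frac1M\sum_{m=1}^M\delta_{(z_{0:t},\theta_t^m)}$. *Assumptions.* Fix $t\ge0$ and assume: 1. for all $x,\xi,x'$ there is $\alpha>0$ with $0<f(x'\mid x,\xi,\theta)<\alpha$ for all $\theta$; 2. for all $1\le s<t$ and all $z_{0:s}$ there is an integrable function $\beta_{s+1}(z_{s+1})$ with $0<p(z_{s+1}\mid z_{0:s},\theta)<\beta_{s+1}(z_{s+1})$ for all $z_{s+1}$ and $\theta$; 3. the target exists, i.e. $Z_t<\infty$; and, only if $\eta>1$, the potential-weighted densities are dominated: there is $B(z_{0:t})$, integrable with respect to $p(dz_0)\,dz_1\cdots dz_t$, with $\prod_{s=0}^{t-1}p(z_{s+1}\mid z_{0:s},\theta_s)\exp\{-\eta\log f(x_{s+1}\mid x_s,\xi_s,\theta_s)\}\le B(z_{0:t})$ for all $z_{0:t}$ and $\theta_0,\dots,\theta_{t-1}\in\Theta$. *Conclusion.* $\Gamma(dz_{0:t},d\theta_t)$ and $\tilde\Gamma_t^M$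 ($M\ge1$) are well-defined probability measures, and for every bounded measurable $\psi(z_{0:t},\theta_t)$, as $M\to\infty$, $$\mathbb E_{\tilde\Gamma_t^M}[\psi(z_{0:t},\theta_t)]\to\mathbb E_{\Gamma}[\psi(z_{0:t},\theta_t)].$$ -/

import Mathlib

open MeasureTheory ProbabilityTheory Filter Topology

namespace SeqDesign

/-- Outcome-design histories `z_{0:t}`: `z_0 = x_0` and `z_{s+1} = (x_{s+1}, ξ_s)` for `s < t`.
The entry `z.2 s` is `z_{s+1}`. -/
abbrev Hist (X Ξ : Type*) (t : ℕ) : Type _ := X × (Fin t → X × Ξ)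

/-- The initial segment `z_{0:t}` of `z_{0:t+1}`. -/
def pre {X Ξ : Type*} {t : ℕ} (z : Hist X Ξ (t + 1)) : Hist X Ξ t := (z.1, Fin.init z.2)

/-- The last outcome-design pair `z_{t+1} = (x_{t+1}, ξ_t)` of `z_{0:t+1}`. -/
def lastPair {X Ξ : Type*} {t : ℕ} (z : Hist X Ξ (t + 1)) : X × Ξ := z.2 (Fin.last t)

/-- The last state `x_t` of `z_{0:t}`. -/
def lastState {X Ξ : Type*} : {t : ℕ} → Hist X Ξ t → X
  | 0, z => z.1
  | _ + 1, z => (lastPair z).1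

/-- A sequential design model with a parameter `θ`: dominating measures for the states and the
designs, the law of `x_0`, the prior, the Markovian transition density
`f x ξ x' θ = f(x' ∣ x, ξ, θ)`, the density `policy t z ξ = π(ξ ∣ z_{0:t})` of the stochastic policy
and the tempering parameter `η`. -/
structure Model (X Ξ Θ : Type*) [MeasurableSpace X] [MeasurableSpace Ξ] [MeasurableSpace Θ] where
  lamX : Measure X
  lamΞ : Measure Ξ
  sigmaFinite_lamX : SigmaFinite lamX
  sigmaFinite_lamΞ : SigmaFinite lamΞ
  init : Measure X
  isProb_init : IsProbabilityMeasure init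
  prior : Measure Θ
  isProb_prior : IsProbabilityMeasure prior
  f : X → Ξ → X → Θ → ℝ
  f_meas : Measurable fun p : X × Ξ × X × Θ => f p.1 p.2.1 p.2.2.1 p.2.2.2
  f_nonneg : ∀ x ξ x' θ, 0 ≤ f x ξ x' θ
  f_density : ∀ x ξ θ, ∫⁻ x', ENNReal.ofReal (f x ξ x' θ) ∂lamX = 1
  policy : (t : ℕ) → Hist X Ξ t → Ξ → ℝ
  policy_meas : ∀ t, Measurable fun p : Hist X Ξ t × Ξ => policy t p.1 p.2
  policy_nonneg : ∀ t z ξ, 0 ≤ policy t z ξ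
  policy_density : ∀ t z, ∫⁻ ξ, ENNReal.ofReal (policy t z ξ) ∂lamΞ = 1
  η : ℝ
  η_pos : 0 < η

attribute [instance] Model.sigmaFinite_lamX Model.sigmaFinite_lamΞ Model.isProb_init
  Model.isProb_prior

noncomputable section

namespace Model

variable {X Ξ Θ : Type*} [MeasurableSpace X] [MeasurableSpace Ξ] [MeasurableSpace Θ]
variable (m : Model X Ξ Θ)

/-- The dominating measure `dz_{t+1} = dx_{t+1} dξ_t`. -/
def lamZ : Measure (X × Ξ) := m.lamX.prod m.lamΞ

/-- The reference measure `p(dz_0) dz_1 ⋯ dz_t` on histories. -/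
def histRef (t : ℕ) : Measure (Hist X Ξ t) :=
  m.init.prod (Measure.pi fun _ : Fin t => m.lamZ)

/-- The conditional density `p(z_{t+1} ∣ z_{0:t}, θ) = f(x_{t+1} ∣ x_t, ξ_t, θ) π(ξ_t ∣ z_{0:t})`. -/
def trans {t : ℕ} (z : Hist X Ξ t) (z' : X × Ξ) (θ : Θ) : ℝ :=
  m.f (lastState z) z'.2 z'.1 θ * m.policy t z z'.2

/-- The likelihood `p(z_{1:t} ∣ z_0, θ)`. -/
def likelihood : {t : ℕ} → Hist X Ξ t → Θ → ℝ
  | 0, _, _ => 1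
  | _ + 1, z, θ => likelihood (pre z) θ * m.trans (pre z) (lastPair z) θ

/-- The density of `p(θ ∣ z_{0:t})` with respect to the prior, by Bayes' rule. -/
def postDensity {t : ℕ} (z : Hist X Ξ t) (θ : Θ) : ℝ :=
  m.likelihood z θ / ∫ θ', m.likelihood z θ' ∂m.prior

/-- The filtered posterior `p(θ ∣ z_{0:t})`. -/
def posterior {t : ℕ} (z : Hist X Ξ t) : Measure Θ :=
  m.prior.withDensity fun θ => ENNReal.ofReal (m.postDensity z θ)

/-- The marginal dynamics `p(z_{t+1} ∣ z_{0:t})`. -/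
def margTrans {t : ℕ} (z : Hist X Ξ t) (z' : X × Ξ) : ℝ :=
  ∫ θ, m.trans z z' θ ∂(m.posterior z)

/-- The marginal state dynamics `p(x_{t+1} ∣ z_{0:t}, ξ_t)`. -/
def margState {t : ℕ} (z : Hist X Ξ t) (z' : X × Ξ) : ℝ :=
  ∫ θ, m.f (lastState z) z'.2 z'.1 θ ∂(m.posterior z)

/-- The potential `g_{t+1}(z_{0:t+1}) = exp (-η log p(x_{t+1} ∣ z_{0:t}, ξ_t))`. -/
def potential {t : ℕ} (z : Hist X Ξ t) (z' : X × Ξ) : ℝ :=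
  Real.exp (-m.η * Real.log (m.margState z z'))

/-- The unnormalized target density `∏_{s=1}^t p(z_s ∣ z_{0:s-1}) g_s(z_{0:s})` with respect to
`histRef`. -/
def targetDensity : {t : ℕ} → Hist X Ξ t → ℝ
  | 0, _ => 1
  | _ + 1, z => targetDensity (pre z) *
      (m.margTrans (pre z) (lastPair z) * m.potential (pre z) (lastPair z))

/-- The normalizing constant `Z_t` of the target. -/
def targetZ (t : ℕ) : ENNReal :=
  ∫⁻ z : Hist X Ξ t, ENNReal.ofReal (m.targetDensity z) ∂(m.histRef t)

/-- The target `Γ(z_{0:t}, θ_t) = Γ(z_{0:t}) p(θ_t ∣ z_{0:t})`. -/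
def target (t : ℕ) : Measure (Hist X Ξ t × Θ) :=
  (m.targetZ t)⁻¹ • ((m.histRef t).prod m.prior).withDensity fun p =>
    ENNReal.ofReal (m.targetDensity p.1) * ENNReal.ofReal (m.postDensity p.1 p.2)

/-- The product `∏_{s=0}^{t-1} p(z_{s+1} ∣ z_{0:s}, θ_s) exp (-η log f(x_{s+1} ∣ x_s, ξ_s, θ_s))` of
potential-weighted conditional densities, along a sequence of parameters `θ_0, …, θ_{t-1}`. -/
def weightedDensity : {t : ℕ} → Hist X Ξ t → (Fin t → Θ) → ℝ
  | 0, _, _ => 1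
  | t + 1, z, θ => weightedDensity (pre z) (Fin.init θ) *
      (m.trans (pre z) (lastPair z) (θ (Fin.last t)) *
        Real.exp (-m.η *
          Real.log (m.f (lastState (pre z)) (lastPair z).2 (lastPair z).1 (θ (Fin.last t)))))

variable {M : ℕ}

/-- The normalized IBIS weights `W^i = v^i / ∑_j v^j`, `v^i = p(z_{t+1} ∣ z_{0:t}, θ_t^i)`. -/
def ibisWeight {t : ℕ} (z : Hist X Ξ (t + 1)) (θ : Fin M → Θ) (i : Fin M) : ℝ :=
  m.trans (pre z) (lastPair z) (θ i) / ∑ j, m.trans (pre z) (lastPair z) (θ j)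

/-- One IBIS step with multinomial resampling: the joint law
`∏_i W^{a^i} K(θ^{a^i}, dθ'^i)` of the new particles and the ancestors, given the old particles. -/
def ibisStep (K : (s : ℕ) → Kernel (Hist X Ξ s × Θ) Θ) {t : ℕ} (z : Hist X Ξ (t + 1))
    (θ : Fin M → Θ) : Measure ((Fin M → Θ) × (Fin M → Fin M)) :=
  ∑ a : Fin M → Fin M, (∏ i, ENNReal.ofReal (m.ibisWeight z θ (a i))) •
    (Measure.pi fun i => K (t + 1) (z, θ (a i))).map fun θ' => (θ', a)

/-- The law of `(θ_{0:t}^{1:M}, a_{1:t}^{1:M})` generated by IBIS along a fixed history `z_{0:t}`: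
the initial particles are i.i.d. from the prior, followed by one IBIS step per time. -/
def ibisLaw (K : (s : ℕ) → Kernel (Hist X Ξ s × Θ) Θ) (M : ℕ) :
    {t : ℕ} → Hist X Ξ t → Measure ((Fin (t + 1) → Fin M → Θ) × (Fin t → Fin M → Fin M))
  | 0, _ => (Measure.pi fun _ : Fin M => m.prior).map fun θ => (fun _ => θ, Fin.elim0)
  | t + 1, z => (ibisLaw K M (pre z)).bind fun p =>
      (m.ibisStep K z (p.1 (Fin.last t))).map fun q =>
        (Fin.snoc (α := fun _ => Fin M → Θ) p.1 q.1,
          Fin.snoc (α := fun _ => Fin M → Fin M) p.2 q.2)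

/-- The trajectory update factor
`(1/M ∑_i p(z_{t+1} ∣ z_{0:t}, θ_t^i)) exp (-η log (1/M ∑_i f(x_{t+1} ∣ x_t, ξ_t, θ_t^i)))`. -/
def updateFactor {t : ℕ} (z : Hist X Ξ t) (z' : X × Ξ) (θ : Fin M → Θ) : ℝ :=
  ((1 / (M : ℝ)) * ∑ i, m.trans z z' (θ i)) *
    Real.exp (-m.η * Real.log ((1 / (M : ℝ)) * ∑ i, m.f (lastState z) z'.2 z'.1 (θ i)))

/-- The product of the trajectory update factors at times `0, …, t-1`. -/
def updateProd : {t : ℕ} → Hist X Ξ t → (Fin (t + 1) → Fin M → Θ) → ℝ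
  | 0, _, _ => 1
  | t + 1, z, θ => updateProd (pre z) (Fin.init θ) *
      m.updateFactor (pre z) (lastPair z) (Fin.init θ (Fin.last t))

/-- The unnormalized law of all the variables `(z_{0:t}, θ_{0:t}^{1:M}, a_{1:t}^{1:M})`: the product
of `p(z_0)`, of the law of the initial particles, and of the trajectory update factors and the IBIS
transitions of all times. -/
def smcUnnorm (K : (s : ℕ) → Kernel (Hist X Ξ s × Θ) Θ) (M t : ℕ) :
    Measure (Hist X Ξ t × (Fin (t + 1) → Fin M → Θ) × (Fin t → Fin M → Fin M)) :=
  ((m.histRef t).bind fun z => (m.ibisLaw K M z).map (Prod.mk z)).withDensity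
    fun e => ENNReal.ofReal (m.updateProd e.1 e.2.1)

/-- The distribution `Γ_t^M(z_{0:t}, θ_{0:t}^{1:M}, a_{1:t}^{1:M})`. -/
def smcLaw (K : (s : ℕ) → Kernel (Hist X Ξ s × Θ) Θ) (M t : ℕ) :
    Measure (Hist X Ξ t × (Fin (t + 1) → Fin M → Θ) × (Fin t → Fin M → Fin M)) :=
  (m.smcUnnorm K M t Set.univ)⁻¹ • m.smcUnnorm K M t

/-- The expected empirical distribution of `(z_{0:t}, θ_t)`: the expectation under `Γ_t^M` of the
random measure `1/M ∑_i δ_{(z_{0:t}, θ_t^i)}`. -/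
def expEmpirical (K : (s : ℕ) → Kernel (Hist X Ξ s × Θ) Θ) (M t : ℕ) :
    Measure (Hist X Ξ t × Θ) :=
  (m.smcLaw K M t).bind fun e =>
    (M : ENNReal)⁻¹ • ∑ i : Fin M, Measure.dirac (e.1, e.2.1 (Fin.last t) i)

end Model

end

end SeqDesign

/-! ### Posteriors, evidence and the closed form of the target density -/

namespace SeqDesign

variable {X Ξ Θ : Type*} [MeasurableSpace X] [MeasurableSpace Ξ] [MeasurableSpace Θ]

/-! Let $\Pi(z)$ be the product of the policy densities along $z$ and $L(z)=p(z_{1:t}\mid z_0)$ the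
evidence. The policy is a common factor of every transition density, so the potentials telescope:
the unnormalized target density is $\Pi^\eta L^{1-\eta}$ (`targetDensity_eq`), and the weight of the
algorithm is $\Pi^\eta \hat L^{1-\eta}$, where $\hat L$ is the product of the predictive density
averages of IBIS (`updateProd_eq`). The claim thus reduces to the convergence of $\hat L$ and of the
particle averages, first at a fixed history and then integrated over histories.

At a fixed history with $\Pi>0$, the new particles are i.i.d. given the old ones, with law a
weighted mixture of mutation kernels. A variance bound, the Bayes update and the invariance of the
kernels give an $L^1$ law of large numbers by induction on time
(`tendsto_lintegral_enorm_pmean_sub`), whence $\hat L\to L$ in $L^1$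
(`tendsto_lintegral_enorm_predProd_sub`). Continuity of the power at $L>0$ and a bound uniform in
$M$ pass this on to the weights. Where $\Pi=0$, both densities vanish because $\eta>0$.

The passage to integrals over histories is dominated convergence. For $\eta\le1$ the power is
concave and $\hat L$ is unbiased (`lintegral_predProd`), so Jensen's inequality bounds the mean
weight by the target density itself, which is integrable. For $\eta>1$ the power is decreasing and
an average is at least its smallest term, so the weight is at most a potential-weighted density,
dominated by assumption. Taking the test function 1 as well gives the normalizing constants, and the
quotient converges. -/

@[fun_prop]
lemma measurable_finInit {α : Type*} [MeasurableSpace α] {n : ℕ} :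
    Measurable (fun q : Fin (n + 1) → α => Fin.init (α := fun _ => α) q) :=
  measurable_pi_lambda _ fun i => measurable_pi_apply i.castSucc

@[fun_prop]
lemma measurable_finSnoc {α : Type*} [MeasurableSpace α] {n : ℕ} :
    Measurable (fun q : (Fin n → α) × α => Fin.snoc (α := fun _ => α) q.1 q.2) := by
  refine measurable_pi_lambda _ fun i => ?_
  refine Fin.lastCases ?_ (fun j => ?_) i
  · simpa using measurable_snd
  · simp only [Fin.snoc_castSucc]
    exact (measurable_pi_apply j).comp measurable_fst

@[fun_prop]
lemma measurable_pre {t : ℕ} : Measurable (pre : Hist X Ξ (t + 1) → Hist X Ξ t) :=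
  measurable_fst.prodMk (measurable_finInit.comp measurable_snd)

@[fun_prop]
lemma measurable_lastPair {t : ℕ} : Measurable (lastPair : Hist X Ξ (t + 1) → X × Ξ) :=
  (measurable_pi_apply _).comp measurable_snd

@[fun_prop]
lemma measurable_lastState : {t : ℕ} → Measurable (lastState : Hist X Ξ t → X)
  | 0 => measurable_fst
  | _ + 1 => measurable_fst.comp measurable_lastPair

/-- The history `z_{0:t+1}` obtained by appending a pair to `z_{0:t}`. -/
def append {t : ℕ} (z : Hist X Ξ t) (z' : X × Ξ) : Hist X Ξ (t + 1) :=
  (z.1, Fin.snoc (α := fun _ => X × Ξ) z.2 z')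

omit [MeasurableSpace X] [MeasurableSpace Ξ] in
@[simp]
lemma pre_append {t : ℕ} (z : Hist X Ξ t) (z' : X × Ξ) : pre (append z z') = z := by
  simp [pre, append]

omit [MeasurableSpace X] [MeasurableSpace Ξ] in
@[simp]
lemma lastPair_append {t : ℕ} (z : Hist X Ξ t) (z' : X × Ξ) : lastPair (append z z') = z' := by
  simp [lastPair, append]

@[fun_prop]
lemma measurable_append {t : ℕ} :
    Measurable fun p : Hist X Ξ t × (X × Ξ) => append p.1 p.2 := by
  refine (measurable_fst.comp measurable_fst).prodMk ?_
  exact measurable_finSnoc.comp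
    ((measurable_snd.comp measurable_fst).prodMk measurable_snd)

/-- Here `a` stands for a policy density and `s` for a state density or an average of such.
Tempering divides by $s^\eta=(as)^\eta/a^\eta$, which leaves powers of `a` and of the joint density
only. For `a = 0` both sides vanish because `η` is positive. -/
lemma mul_exp_neg_mul_log {η : ℝ} (hη : 0 < η) {a s : ℝ} (ha : 0 ≤ a) (hs : 0 < s) :
    a * s * Real.exp (-η * Real.log s) = a ^ η * (a * s) ^ (1 - η) := by
  rcases ha.eq_or_lt with rfl | ha
  · simp [Real.zero_rpow hη.ne']
  · rw [Real.mul_rpow ha.le hs.le, ← mul_assoc, ← Real.rpow_add ha, mul_comm (-η),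
      ← Real.rpow_def_of_pos hs, add_sub_cancel, Real.rpow_one, mul_assoc, sub_eq_add_neg,
      Real.rpow_add hs, Real.rpow_one]

namespace Model

variable (m : Model X Ξ Θ)

/-- The transition density is positive and bounded in the parameter. -/
def PosBounded : Prop :=
  ∀ (x : X) (ξ : Ξ) (x' : X), ∃ α : ℝ, 0 < α ∧ ∀ θ, 0 < m.f x ξ x' θ ∧ m.f x ξ x' θ < α

/-- The posterior normalizing constant `p(z_{1:t} ∣ z_0)`. -/
noncomputable def evidence {t : ℕ} (z : Hist X Ξ t) : ℝ := ∫ θ, m.likelihood z θ ∂m.prior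

/-- The product of the policy densities along a history. -/
noncomputable def policyProd : {t : ℕ} → Hist X Ξ t → ℝ
  | 0, _ => 1
  | t + 1, z => policyProd (pre z) * m.policy t (pre z) (lastPair z).2

lemma measurable_f_comp {Y : Type*} [MeasurableSpace Y] {a : Y → X} {b : Y → Ξ} {c : Y → X}
    {d : Y → Θ} (ha : Measurable a) (hb : Measurable b) (hc : Measurable c) (hd : Measurable d) :
    Measurable fun y => m.f (a y) (b y) (c y) (d y) :=
  m.f_meas.comp (ha.prodMk (hb.prodMk (hc.prodMk hd)))

lemma measurable_policy_comp {Y : Type*} [MeasurableSpace Y] {t : ℕ} {a : Y → Hist X Ξ t}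
    {b : Y → Ξ} (ha : Measurable a) (hb : Measurable b) :
    Measurable fun y => m.policy t (a y) (b y) :=
  (m.policy_meas t).comp (ha.prodMk hb)

lemma measurable_trans_comp {Y : Type*} [MeasurableSpace Y] {t : ℕ} {a : Y → Hist X Ξ t}
    {b : Y → X × Ξ} {c : Y → Θ} (ha : Measurable a) (hb : Measurable b) (hc : Measurable c) :
    Measurable fun y => m.trans (a y) (b y) (c y) :=
  (m.measurable_f_comp (measurable_lastState.comp ha) hb.snd hb.fst hc).mul
    (m.measurable_policy_comp ha hb.snd)

lemma measurable_trans {t : ℕ} (z : Hist X Ξ t) (z' : X × Ξ) : Measurable (m.trans z z') :=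
  m.measurable_trans_comp measurable_const measurable_const measurable_id

lemma measurable_likelihood_uncurry : {t : ℕ} →
    Measurable fun p : Hist X Ξ t × Θ => m.likelihood p.1 p.2
  | 0 => measurable_const
  | _ + 1 => by
    refine Measurable.mul ?_ (m.measurable_trans_comp ?_ ?_ measurable_snd)
    · exact measurable_likelihood_uncurry.comp
        ((measurable_pre.comp measurable_fst).prodMk measurable_snd)
    · exact measurable_pre.comp measurable_fst
    · exact measurable_lastPair.comp measurable_fst

lemma measurable_likelihood {t : ℕ} (z : Hist X Ξ t) : Measurable (m.likelihood z) :=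
  m.measurable_likelihood_uncurry.comp measurable_prodMk_left

lemma measurable_evidence {t : ℕ} : Measurable (m.evidence : Hist X Ξ t → ℝ) :=
  (m.measurable_likelihood_uncurry.stronglyMeasurable.integral_prod_right
    (ν := m.prior)).measurable

lemma measurable_policyProd : {t : ℕ} → Measurable (m.policyProd : Hist X Ξ t → ℝ)
  | 0 => measurable_const
  | _ + 1 => (measurable_policyProd.comp measurable_pre).mul
      (m.measurable_policy_comp measurable_pre measurable_lastPair.snd)

lemma measurable_postDensity {t : ℕ} :
    Measurable fun p : Hist X Ξ t × Θ => m.postDensity p.1 p.2 :=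
  m.measurable_likelihood_uncurry.div (m.measurable_evidence.comp measurable_fst)

lemma trans_nonneg {t : ℕ} (z : Hist X Ξ t) (z' : X × Ξ) (θ : Θ) : 0 ≤ m.trans z z' θ :=
  mul_nonneg (m.f_nonneg _ _ _ _) (m.policy_nonneg _ _ _)

lemma likelihood_nonneg : {t : ℕ} → (z : Hist X Ξ t) → (θ : Θ) → 0 ≤ m.likelihood z θ
  | 0, _, _ => zero_le_one
  | _ + 1, z, θ => mul_nonneg (likelihood_nonneg (pre z) θ) (m.trans_nonneg _ _ _)

lemma policyProd_nonneg : {t : ℕ} → (z : Hist X Ξ t) → 0 ≤ m.policyProd z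
  | 0, _ => zero_le_one
  | _ + 1, z => mul_nonneg (policyProd_nonneg (pre z)) (m.policy_nonneg _ _ _)

lemma evidence_nonneg {t : ℕ} (z : Hist X Ξ t) : 0 ≤ m.evidence z :=
  integral_nonneg fun θ => m.likelihood_nonneg z θ

lemma postDensity_nonneg {t : ℕ} (z : Hist X Ξ t) (θ : Θ) : 0 ≤ m.postDensity z θ :=
  div_nonneg (m.likelihood_nonneg z θ) (m.evidence_nonneg z)

lemma policyProd_pos_iff {t : ℕ} (z : Hist X Ξ (t + 1)) :
    0 < m.policyProd z ↔ 0 < m.policyProd (pre z) ∧ 0 < m.policy t (pre z) (lastPair z).2 := by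
  have h1 := m.policyProd_nonneg (pre z)
  have h2 := m.policy_nonneg t (pre z) (lastPair z).2
  constructor
  · intro h
    exact ⟨pos_of_mul_pos_left h h2, pos_of_mul_pos_right h h1⟩
  · exact fun h => mul_pos h.1 h.2

lemma likelihood_eq_zero : {t : ℕ} → (z : Hist X Ξ t) → m.policyProd z = 0 → (θ : Θ) →
    m.likelihood z θ = 0
  | 0, _, h, _ => absurd h one_ne_zero
  | t + 1, z, h, θ => by
    rcases mul_eq_zero.1 h with h | h
    · simp [likelihood, likelihood_eq_zero (pre z) h θ]
    · simp [likelihood, trans, h]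

lemma evidence_eq_zero {t : ℕ} {z : Hist X Ξ t} (h : m.policyProd z = 0) : m.evidence z = 0 := by
  simp [evidence, m.likelihood_eq_zero z h]

/-- No positivity is needed: if the evidence is zero, division by zero makes both sides zero. -/
lemma integral_posterior {t : ℕ} (z : Hist X Ξ t) (h : Θ → ℝ) :
    ∫ θ, h θ ∂m.posterior z = (∫ θ, m.likelihood z θ * h θ ∂m.prior) / m.evidence z := by
  have hm : Measurable fun θ => ENNReal.ofReal (m.postDensity z θ) :=
    (m.measurable_postDensity.comp measurable_prodMk_left).ennreal_ofReal
  rw [posterior, integral_withDensity_eq_integral_toReal_smul hm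
    (ae_of_all _ fun _ => ENNReal.ofReal_lt_top), ← integral_div]
  refine integral_congr_ae (ae_of_all _ fun θ => ?_)
  simp only [ENNReal.toReal_ofReal (m.postDensity_nonneg z θ), smul_eq_mul]
  simp only [postDensity, evidence]
  ring

lemma lintegral_posterior {t : ℕ} (z : Hist X Ξ t) {h : Θ → ENNReal} (hh : Measurable h) :
    ∫⁻ θ, h θ ∂m.posterior z = ∫⁻ θ, ENNReal.ofReal (m.postDensity z θ) * h θ ∂m.prior := by
  have hm : Measurable fun θ => ENNReal.ofReal (m.postDensity z θ) :=
    (m.measurable_postDensity.comp measurable_prodMk_left).ennreal_ofReal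
  rw [posterior, lintegral_withDensity_eq_lintegral_mul _ hm hh]
  rfl

namespace PosBounded

variable {m} (hf : m.PosBounded)
include hf

lemma trans_pos {t : ℕ} (z : Hist X Ξ t) (z' : X × Ξ) (hz : 0 < m.policy t z z'.2) (θ : Θ) :
    0 < m.trans z z' θ := by
  obtain ⟨_, _, h⟩ := hf (lastState z) z'.2 z'.1
  exact mul_pos (h θ).1 hz

lemma trans_le {t : ℕ} (z : Hist X Ξ t) (z' : X × Ξ) : ∃ C, ∀ θ, m.trans z z' θ ≤ C := by
  obtain ⟨α, _, h⟩ := hf (lastState z) z'.2 z'.1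
  exact ⟨α * m.policy t z z'.2, fun θ =>
    mul_le_mul_of_nonneg_right (h θ).2.le (m.policy_nonneg _ _ _)⟩

lemma likelihood_le : {t : ℕ} → (z : Hist X Ξ t) → ∃ C, ∀ θ, m.likelihood z θ ≤ C
  | 0, _ => ⟨1, fun _ => le_rfl⟩
  | _ + 1, z => by
    obtain ⟨C, hC⟩ := likelihood_le (pre z)
    obtain ⟨D, hD⟩ := hf.trans_le (pre z) (lastPair z)
    refine ⟨C * D, fun θ => ?_⟩
    exact mul_le_mul (hC θ) (hD θ) (m.trans_nonneg _ _ _)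
      ((m.likelihood_nonneg _ θ).trans (hC θ))

lemma likelihood_pos : {t : ℕ} → (z : Hist X Ξ t) → 0 < m.policyProd z → (θ : Θ) →
    0 < m.likelihood z θ
  | 0, _, _, _ => zero_lt_one
  | t + 1, z, h, θ => by
    obtain ⟨h1, h2⟩ := (m.policyProd_pos_iff z).1 h
    exact mul_pos (likelihood_pos (pre z) h1 θ) (hf.trans_pos _ _ h2 θ)

lemma integrable_likelihood {t : ℕ} (z : Hist X Ξ t) : Integrable (m.likelihood z) m.prior := by
  obtain ⟨C, hC⟩ := hf.likelihood_le z
  refine Integrable.of_bound (m.measurable_likelihood z).aestronglyMeasurable C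
    (ae_of_all _ fun θ => ?_)
  rw [Real.norm_of_nonneg (m.likelihood_nonneg z θ)]
  exact hC θ

lemma evidence_pos {t : ℕ} {z : Hist X Ξ t} (hz : 0 < m.policyProd z) : 0 < m.evidence z := by
  rw [evidence, integral_pos_iff_support_of_nonneg (m.likelihood_nonneg z)
    (hf.integrable_likelihood z)]
  rw [Function.support_eq_univ fun θ => (hf.likelihood_pos z hz θ).ne']
  simp

lemma ofReal_evidence {t : ℕ} (z : Hist X Ξ t) :
    ENNReal.ofReal (m.evidence z) = ∫⁻ θ, ENNReal.ofReal (m.likelihood z θ) ∂m.prior :=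
  ofReal_integral_eq_lintegral_ofReal (hf.integrable_likelihood z)
    (ae_of_all _ (m.likelihood_nonneg z))

lemma isProbabilityMeasure_posterior {t : ℕ} {z : Hist X Ξ t} (hz : 0 < m.policyProd z) :
    IsProbabilityMeasure (m.posterior z) := by
  have he := hf.evidence_pos hz
  refine ⟨?_⟩
  rw [posterior, withDensity_apply _ MeasurableSet.univ, Measure.restrict_univ,
    ← ofReal_integral_eq_lintegral_ofReal (f := m.postDensity z)
      ((hf.integrable_likelihood z).div_const _) (ae_of_all _ (m.postDensity_nonneg z))]
  simp only [postDensity]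
  rw [integral_div, ← evidence, div_self he.ne', ENNReal.ofReal_one]

omit hf in
-- Integrating one more transition against the unnormalized posterior produces the next evidence, so
-- products of these ratios telescope.
lemma margTrans_eq {t : ℕ} (z : Hist X Ξ (t + 1)) :
    m.margTrans (pre z) (lastPair z) = m.evidence z / m.evidence (pre z) := by
  rw [margTrans, integral_posterior]
  rfl

omit hf in
lemma margTrans_eq_margState_mul {t : ℕ} (z : Hist X Ξ t) (z' : X × Ξ) :
    m.margTrans z z' = m.policy t z z'.2 * m.margState z z' := by
  simp only [margTrans, margState, trans]
  rw [integral_mul_const, mul_comm]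

/-- Induction on time: each new factor is brought to the form $a^\eta(as)^{1-\eta}$, and $as$ is the
ratio of successive evidences. -/
lemma targetDensity_eq : {t : ℕ} → (z : Hist X Ξ t) →
    m.targetDensity z = m.policyProd z ^ m.η * m.evidence z ^ (1 - m.η)
  | 0, z => by simp [targetDensity, policyProd, evidence, likelihood]
  | t + 1, z => by
    have hη := m.η_pos
    rw [targetDensity, targetDensity_eq (pre z)]
    rcases (m.policyProd_nonneg z).eq_or_lt with h | h
    -- The policy vanishes either before the last step, where the induction hypothesis gives zero,
    -- or at the last step, where the marginal transition density is zero.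
    · rw [← h, Real.zero_rpow hη.ne', zero_mul]
      rcases mul_eq_zero.1 h.symm with h | h
      · rw [h, Real.zero_rpow hη.ne']
        simp
      · rw [margTrans_eq_margState_mul, h]
        simp
    · obtain ⟨h1, h2⟩ := (m.policyProd_pos_iff z).1 h
      have e1 := hf.evidence_pos h1
      have e2 := hf.evidence_pos h
      have e3 : m.evidence z = m.evidence (pre z) *
          (m.policy t (pre z) (lastPair z).2 * m.margState (pre z) (lastPair z)) := by
        rw [← margTrans_eq_margState_mul, margTrans_eq, mul_div_cancel₀ _ e1.ne']
      have e4 : 0 < m.margState (pre z) (lastPair z) := by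
        rw [e3] at e2
        exact pos_of_mul_pos_right (pos_of_mul_pos_right e2 e1.le) h2.le
      rw [margTrans_eq_margState_mul, potential, mul_exp_neg_mul_log hη h2.le e4, e3,
        Real.mul_rpow e1.le (mul_pos h2 e4).le, policyProd, Real.mul_rpow h1.le h2.le]
      ring

end PosBounded

end Model

end SeqDesign

/-! ### IBIS steps and unbiasedness of the evidence estimate -/

namespace SeqDesign

variable {X Ξ Θ : Type*} [MeasurableSpace X] [MeasurableSpace Ξ] [MeasurableSpace Θ]

lemma measurable_measure_pi {ι Y : Type*} [Fintype ι] [MeasurableSpace Y] {κ : Y → ι → Measure Θ}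
    [∀ y i, IsProbabilityMeasure (κ y i)] (hκ : ∀ i, Measurable fun y => κ y i) :
    Measurable fun y => Measure.pi (κ y) := by
  refine Measurable.measure_of_isPiSystem_of_isProbabilityMeasure generateFrom_pi.symm
    isPiSystem_pi ?_
  rintro _ ⟨s, hs, rfl⟩
  simp_rw [Measure.pi_pi]
  exact Finset.measurable_prod _ fun i _ =>
    (Measure.measurable_coe (hs i (Set.mem_univ i))).comp (hκ i)

lemma measurable_map_kernel {α β γ : Type*} [MeasurableSpace α] [MeasurableSpace β]
    [MeasurableSpace γ] (κ : Kernel α β) [IsSFiniteKernel κ] {F : α → β → γ}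
    (hF : Measurable fun y : α × β => F y.1 y.2) : Measurable fun a => (κ a).map (F a) := by
  refine Measure.measurable_of_measurable_coe _ fun s hs => ?_
  have h (a : α) : (κ a).map (F a) s = κ a (Prod.mk a ⁻¹' ((fun y : α × β => F y.1 y.2) ⁻¹' s)) :=
    Measure.map_apply (hF.comp measurable_prodMk_left) hs
  simp_rw [h]
  exact Kernel.measurable_kernel_prodMk_left (hF hs)

/-- The average of a function over a particle system. -/
noncomputable def pmean {M : ℕ} (g : Θ → ℝ) (θ : Fin M → Θ) : ℝ := (1 / (M : ℝ)) * ∑ i, g (θ i)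

/-- The average of an `ℝ≥0∞`-valued function over a particle system. -/
noncomputable def lmean {M : ℕ} (g : Θ → ENNReal) (θ : Fin M → Θ) : ENNReal :=
  (M : ENNReal)⁻¹ * ∑ i, g (θ i)

lemma measurable_pmean {M : ℕ} {g : Θ → ℝ} (hg : Measurable g) :
    Measurable (pmean g : (Fin M → Θ) → ℝ) :=
  (Finset.measurable_sum _ fun i _ => hg.comp (measurable_pi_apply i)).const_mul _

lemma measurable_lmean {M : ℕ} {g : Θ → ENNReal} (hg : Measurable g) :
    Measurable (lmean g : (Fin M → Θ) → ENNReal) :=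
  (Finset.measurable_sum _ fun i _ => hg.comp (measurable_pi_apply i)).const_mul _

omit [MeasurableSpace Θ] in
lemma pmean_nonneg {M : ℕ} {g : Θ → ℝ} (hg : ∀ θ, 0 ≤ g θ) (θ : Fin M → Θ) : 0 ≤ pmean g θ :=
  mul_nonneg (by positivity) (Finset.sum_nonneg fun i _ => hg _)

omit [MeasurableSpace Θ] in
lemma ofReal_pmean {M : ℕ} {g : Θ → ℝ} (hg : ∀ θ, 0 ≤ g θ) (hM : M ≠ 0) (θ : Fin M → Θ) :
    ENNReal.ofReal (pmean g θ) = lmean (fun x => ENNReal.ofReal (g x)) θ := by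
  rw [pmean, ENNReal.ofReal_mul (by positivity), ENNReal.ofReal_sum_of_nonneg fun i _ => hg _,
    one_div, ENNReal.ofReal_inv_of_pos (by positivity), ENNReal.ofReal_natCast, lmean]

omit [MeasurableSpace Θ] in
lemma lmean_const {M : ℕ} (hM : M ≠ 0) (c : ENNReal) (θ : Fin M → Θ) :
    lmean (fun _ => c) θ = c := by
  rw [lmean, Finset.sum_const, Finset.card_univ, Fintype.card_fin, nsmul_eq_mul, ← mul_assoc,
    ENNReal.inv_mul_cancel (by simpa using hM) (by simp), one_mul]

lemma lintegral_lmean_pi {M : ℕ} (hM : M ≠ 0) (ν : Measure Θ) [IsProbabilityMeasure ν]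
    {g : Θ → ENNReal} (hg : Measurable g) :
    ∫⁻ θ, lmean g θ ∂(Measure.pi fun _ : Fin M => ν) = ∫⁻ x, g x ∂ν := by
  have hm : ∀ i : Fin M, Measurable fun θ : Fin M → Θ => g (θ i) :=
    fun i => hg.comp (measurable_pi_apply i)
  simp only [lmean]
  rw [lintegral_const_mul _ (Finset.measurable_sum _ fun i _ => hm i),
    lintegral_finsetSum _ fun i _ => hm i]
  have : ∀ i : Fin M, ∫⁻ θ : Fin M → Θ, g (θ i) ∂(Measure.pi fun _ => ν) = ∫⁻ x, g x ∂ν :=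
    fun i => (measurePreserving_eval (fun _ : Fin M => ν) i).lintegral_comp hg
  simp only [this, Finset.sum_const, Finset.card_univ, Fintype.card_fin, nsmul_eq_mul]
  rw [← mul_assoc, ENNReal.inv_mul_cancel (by simpa using hM) (by simp), one_mul]

namespace Model

variable (m : Model X Ξ Θ) (K : (s : ℕ) → Kernel (Hist X Ξ s × Θ) Θ) {M : ℕ}

/-- The law of one resampled and mutated particle. -/
noncomputable def mixture {t : ℕ} (z : Hist X Ξ (t + 1)) (θ : Fin M → Θ) : Measure Θ :=
  ∑ j, ENNReal.ofReal (m.ibisWeight z θ j) • K (t + 1) (z, θ j)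

lemma ibisWeight_nonneg {t : ℕ} (z : Hist X Ξ (t + 1)) (θ : Fin M → Θ) (i : Fin M) :
    0 ≤ m.ibisWeight z θ i :=
  div_nonneg (m.trans_nonneg _ _ _) (Finset.sum_nonneg fun _ _ => m.trans_nonneg _ _ _)

lemma measurable_ibisWeight {t : ℕ} (i : Fin M) :
    Measurable fun p : Hist X Ξ (t + 1) × (Fin M → Θ) => m.ibisWeight p.1 p.2 i := by
  have h : ∀ j : Fin M, Measurable fun p : Hist X Ξ (t + 1) × (Fin M → Θ) =>
      m.trans (pre p.1) (lastPair p.1) (p.2 j) := fun j =>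
    m.measurable_trans_comp (measurable_pre.comp measurable_fst)
      (measurable_lastPair.comp measurable_fst) ((measurable_pi_apply j).comp measurable_snd)
  exact (h i).div (Finset.measurable_sum _ fun j _ => h j)

lemma sum_ibisWeight_of_pos {t : ℕ} {z : Hist X Ξ (t + 1)} {θ : Fin M → Θ}
    (h : 0 < ∑ j, m.trans (pre z) (lastPair z) (θ j)) : ∑ j, m.ibisWeight z θ j = 1 := by
  simp only [ibisWeight]
  rw [← Finset.sum_div, div_self h.ne']

/-- Only an inequality holds in general: if the policy density is zero, all weights are `0 / 0 = 0`.
For this reason the IBIS laws are treated as sub-probabilities until positivity is available. -/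
lemma sum_ibisWeight_le {t : ℕ} (z : Hist X Ξ (t + 1)) (θ : Fin M → Θ) :
    ∑ j, m.ibisWeight z θ j ≤ 1 := by
  simp only [ibisWeight]
  rw [← Finset.sum_div]
  exact div_self_le_one _

section Markov

variable [∀ s, IsMarkovKernel (K s)]

lemma mixture_univ {t : ℕ} (z : Hist X Ξ (t + 1)) (θ : Fin M → Θ) :
    m.mixture K z θ Set.univ = ENNReal.ofReal (∑ j, m.ibisWeight z θ j) := by
  rw [ENNReal.ofReal_sum_of_nonneg fun _ _ => m.ibisWeight_nonneg _ _ _]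
  simp [mixture]

instance isFiniteMeasure_mixture {t : ℕ} (z : Hist X Ξ (t + 1)) (θ : Fin M → Θ) :
    IsFiniteMeasure (m.mixture K z θ) :=
  ⟨by rw [mixture_univ]; exact ENNReal.ofReal_lt_top⟩

lemma isProbabilityMeasure_mixture {t : ℕ} {z : Hist X Ξ (t + 1)} {θ : Fin M → Θ}
    (h : 0 < ∑ j, m.trans (pre z) (lastPair z) (θ j)) :
    IsProbabilityMeasure (m.mixture K z θ) :=
  ⟨by rw [mixture_univ, m.sum_ibisWeight_of_pos h, ENNReal.ofReal_one]⟩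

omit [∀ s, IsMarkovKernel (K s)] in
lemma ibisStep_apply {t : ℕ} (z : Hist X Ξ (t + 1)) (θ : Fin M → Θ)
    {s : Set ((Fin M → Θ) × (Fin M → Fin M))} (hs : MeasurableSet s) :
    m.ibisStep K z θ s = ∑ a : Fin M → Fin M, (∏ i, ENNReal.ofReal (m.ibisWeight z θ (a i))) *
      Measure.pi (fun i => K (t + 1) (z, θ (a i))) {θ' | (θ', a) ∈ s} := by
  rw [ibisStep, Measure.finsetSum_apply]
  refine Finset.sum_congr rfl fun a _ => ?_
  rw [Measure.smul_apply, Measure.map_apply measurable_prodMk_right hs]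
  rfl

lemma measurable_ibisStep {t : ℕ} :
    Measurable fun p : Hist X Ξ (t + 1) × (Fin M → Θ) => m.ibisStep K p.1 p.2 := by
  refine Measure.measurable_of_measurable_coe _ fun s hs => ?_
  simp_rw [m.ibisStep_apply K _ _ hs]
  refine Finset.measurable_sum _ fun a _ => Measurable.mul ?_ ?_
  · exact Finset.measurable_prod _ fun i _ => (m.measurable_ibisWeight (a i)).ennreal_ofReal
  · refine (Measure.measurable_coe (measurable_prodMk_right hs)).comp
      (measurable_measure_pi fun i => (K (t + 1)).measurable.comp ?_)
    exact measurable_fst.prodMk ((measurable_pi_apply (a i)).comp measurable_snd)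

/-- Expanding a product of sums over $j$ gives a sum over all ancestor maps. Forgetting the
ancestors of a multinomial resampling step therefore leaves particles that are i.i.d. given the old
ones. -/
lemma map_fst_ibisStep {t : ℕ} (z : Hist X Ξ (t + 1)) (θ : Fin M → Θ) :
    (m.ibisStep K z θ).map Prod.fst = Measure.pi fun _ => m.mixture K z θ := by
  refine (Measure.pi_eq fun s hs => ?_).symm
  rw [Measure.map_apply measurable_fst (MeasurableSet.univ_pi hs),
    m.ibisStep_apply K z θ (measurable_fst (MeasurableSet.univ_pi hs))]
  simp only [mixture, Measure.finsetSum_apply, Measure.smul_apply, smul_eq_mul]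
  rw [Finset.prod_univ_sum, Fintype.piFinset_univ]
  refine Finset.sum_congr rfl fun a _ => ?_
  rw [Finset.prod_mul_distrib]
  congr 1
  exact Measure.pi_pi _ _

lemma ibisStep_univ_le {t : ℕ} (z : Hist X Ξ (t + 1)) (θ : Fin M → Θ) :
    m.ibisStep K z θ Set.univ ≤ 1 := by
  have h := congrArg (fun μ => μ Set.univ) (m.map_fst_ibisStep K z θ)
  simp only [Measure.map_apply measurable_fst MeasurableSet.univ, Set.preimage_univ,
    Measure.pi_univ, mixture_univ] at h
  rw [h]
  exact Finset.prod_le_one' fun _ _ => ENNReal.ofReal_le_one.2 (m.sum_ibisWeight_le z θ)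


/-- The particles and ancestors produced by IBIS up to time `t`. -/
abbrev Part (Θ : Type*) (M t : ℕ) : Type _ := (Fin (t + 1) → Fin M → Θ) × (Fin t → Fin M → Fin M)

/-- The extension of a particle history by new particles and ancestors. -/
def extend {t : ℕ} (p : Part Θ M t) (q : (Fin M → Θ) × (Fin M → Fin M)) : Part Θ M (t + 1) :=
  (Fin.snoc (α := fun _ => Fin M → Θ) p.1 q.1, Fin.snoc (α := fun _ => Fin M → Fin M) p.2 q.2)

omit m K in
lemma measurable_extend {t : ℕ} :
    Measurable fun x : Part Θ M t × ((Fin M → Θ) × (Fin M → Fin M)) => extend x.1 x.2 :=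
  (measurable_finSnoc.comp ((measurable_fst.comp measurable_fst).prodMk
    (measurable_fst.comp measurable_snd))).prodMk
  (measurable_finSnoc.comp ((measurable_snd.comp measurable_fst).prodMk
    (measurable_snd.comp measurable_snd)))

omit m K in
lemma measurable_extend_left {t : ℕ} (p : Part Θ M t) :
    Measurable (extend p : (Fin M → Θ) × (Fin M → Fin M) → Part Θ M (t + 1)) :=
  measurable_extend.comp measurable_prodMk_left

lemma measurable_map_extend_ibisStep {t : ℕ} :
    Measurable fun x : Hist X Ξ (t + 1) × Part Θ M t =>
      (m.ibisStep K x.1 (x.2.1 (Fin.last t))).map (extend x.2) := by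
  have hl : Measurable fun x : Hist X Ξ (t + 1) × Part Θ M t => (x.1, x.2.1 (Fin.last t)) := by
    refine measurable_fst.prodMk ?_
    exact (measurable_pi_apply (Fin.last t)).comp (measurable_fst.comp measurable_snd)
  let κ : Kernel (Hist X Ξ (t + 1) × Part Θ M t) ((Fin M → Θ) × (Fin M → Fin M)) :=
    Kernel.comap ⟨fun p : Hist X Ξ (t + 1) × (Fin M → Θ) => m.ibisStep K p.1 p.2,
      m.measurable_ibisStep K⟩ _ hl
  have : IsFiniteKernel κ := ⟨1, ENNReal.one_lt_top, fun x => m.ibisStep_univ_le K _ _⟩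
  have he : Measurable fun y : (Hist X Ξ (t + 1) × Part Θ M t) ×
      ((Fin M → Θ) × (Fin M → Fin M)) => extend y.1.2 y.2 :=
    measurable_extend.comp ((measurable_snd.comp measurable_fst).prodMk measurable_snd)
  exact measurable_map_kernel κ he

/-- The two claims are proved together: the mass bound makes the law at time `t` a finite kernel,
and this is used to integrate measurably at time `t + 1`. -/
lemma measurable_ibisLaw_and_le : (t : ℕ) →
    Measurable (m.ibisLaw K M : Hist X Ξ t → Measure (Part Θ M t)) ∧
      ∀ z : Hist X Ξ t, m.ibisLaw K M z Set.univ ≤ 1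
  | 0 => by
    refine ⟨measurable_const, fun z => ?_⟩
    rw [ibisLaw, Measure.map_apply (by fun_prop) MeasurableSet.univ]
    simp
  | t + 1 => by
    obtain ⟨h1, h2⟩ := measurable_ibisLaw_and_le t
    let κ : Kernel (Hist X Ξ (t + 1)) (Part Θ M t) :=
      ⟨fun z => m.ibisLaw K M (pre z), h1.comp measurable_pre⟩
    have : IsFiniteKernel κ := ⟨1, ENNReal.one_lt_top, fun z => h2 _⟩
    have h3 := m.measurable_map_extend_ibisStep K (M := M) (t := t)
    have h4 : ∀ z : Hist X Ξ (t + 1), ∀ s, MeasurableSet s → m.ibisLaw K M z s =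
        ∫⁻ p, (m.ibisStep K z (p.1 (Fin.last t))).map (extend p) s ∂κ z := fun z s hs =>
      Measure.bind_apply hs (h3.comp measurable_prodMk_left).aemeasurable
    constructor
    · refine Measure.measurable_of_measurable_coe _ fun s hs => ?_
      simp_rw [h4 _ s hs]
      exact Measurable.lintegral_kernel_prod_right ((Measure.measurable_coe hs).comp h3)
    · intro z
      rw [h4 _ _ MeasurableSet.univ]
      calc _ ≤ ∫⁻ p, 1 ∂κ z := by
            refine lintegral_mono fun p => ?_
            rw [Measure.map_apply (measurable_extend_left _)
              MeasurableSet.univ]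
            exact m.ibisStep_univ_le K _ _
        _ ≤ 1 := by
            rw [lintegral_one]
            exact h2 _

lemma measurable_ibisLaw (t : ℕ) :
    Measurable (m.ibisLaw K M : Hist X Ξ t → Measure (Part Θ M t)) :=
  (m.measurable_ibisLaw_and_le K t).1

lemma ibisLaw_univ_le {t : ℕ} (z : Hist X Ξ t) : m.ibisLaw K M z Set.univ ≤ 1 :=
  (m.measurable_ibisLaw_and_le K t).2 z

omit [∀ s, IsMarkovKernel (K s)] in
lemma lintegral_ibisLaw_zero (z : Hist X Ξ 0) {g : (Fin 1 → Fin M → Θ) → ENNReal}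
    (hg : Measurable g) :
    ∫⁻ e, g e.1 ∂m.ibisLaw K M z = ∫⁻ θ, g (fun _ => θ) ∂(Measure.pi fun _ => m.prior) := by
  exact lintegral_map (hg.comp measurable_fst) (by fun_prop)

lemma lintegral_ibisLaw_succ {t : ℕ} (z : Hist X Ξ (t + 1))
    {g : (Fin (t + 2) → Fin M → Θ) → ENNReal} (hg : Measurable g) :
    ∫⁻ e, g e.1 ∂m.ibisLaw K M z = ∫⁻ p, ∫⁻ θ, g (Fin.snoc (α := fun _ => Fin M → Θ) p.1 θ)
      ∂(Measure.pi fun _ => m.mixture K z (p.1 (Fin.last t))) ∂m.ibisLaw K M (pre z) := by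
  have h3 := (m.measurable_map_extend_ibisStep K (M := M) (t := t)).comp
    (measurable_prodMk_left (x := z))
  refine (Measure.lintegral_bind h3.aemeasurable (hg.comp measurable_fst).aemeasurable).trans ?_
  refine lintegral_congr fun p => ?_
  have h5 : Measurable fun θ => g (Fin.snoc (α := fun _ => Fin M → Θ) p.1 θ) :=
    hg.comp (measurable_finSnoc.comp measurable_prodMk_left)
  rw [← m.map_fst_ibisStep K, lintegral_map h5 measurable_fst]
  exact lintegral_map (hg.comp measurable_fst) (measurable_extend_left _)

/-- The product `∏_s 1/M ∑_i p(z_{s+1} ∣ z_{0:s}, θ_s^i)` of the predictive density estimates. -/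
noncomputable def predProd : {t : ℕ} → Hist X Ξ t → (Fin (t + 1) → Fin M → Θ) → ℝ
  | 0, _, _ => 1
  | t + 1, z, θ => predProd (pre z) (Fin.init θ) *
      pmean (m.trans (pre z) (lastPair z)) (Fin.init θ (Fin.last t))

lemma predProd_nonneg : {t : ℕ} → (z : Hist X Ξ t) → (θ : Fin (t + 1) → Fin M → Θ) →
    0 ≤ m.predProd z θ
  | 0, _, _ => zero_le_one
  | _ + 1, z, _ => mul_nonneg (predProd_nonneg (pre z) _) (pmean_nonneg (m.trans_nonneg _ _) _)

lemma measurable_predProd : {t : ℕ} →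
    Measurable fun p : Hist X Ξ t × (Fin (t + 1) → Fin M → Θ) => m.predProd p.1 p.2
  | 0 => measurable_const
  | t + 1 => by
    refine Measurable.mul ?_ (Measurable.const_mul (Finset.measurable_sum _ fun i _ => ?_) _)
    · exact measurable_predProd.comp ((measurable_pre.comp measurable_fst).prodMk
        (measurable_finInit.comp measurable_snd))
    · refine m.measurable_trans_comp (measurable_pre.comp measurable_fst)
        (measurable_lastPair.comp measurable_fst) ?_
      exact (measurable_pi_apply i).comp ((measurable_pi_apply (Fin.last t)).comp
        (measurable_finInit.comp measurable_snd))

omit [∀ s, IsMarkovKernel (K s)] in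
lemma lintegral_mixture {t : ℕ} (z : Hist X Ξ (t + 1)) (θ : Fin M → Θ) (h : Θ → ENNReal) :
    ∫⁻ x, h x ∂m.mixture K z θ =
      ∑ j, ENNReal.ofReal (m.ibisWeight z θ j) * ∫⁻ x, h x ∂K (t + 1) (z, θ j) := by
  rw [mixture, lintegral_finsetSum_measure]
  simp [lintegral_smul_measure]

/-- One-step unbiasedness: the average transition density cancels the denominator of the resampling
weights. -/
lemma ofReal_pmean_mul_lintegral_pi_mixture (hM : M ≠ 0) {t : ℕ} (z : Hist X Ξ (t + 1))
    (θ : Fin M → Θ) {h : Θ → ENNReal} (hh : Measurable h) :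
    ENNReal.ofReal (pmean (m.trans (pre z) (lastPair z)) θ) *
        ∫⁻ θ', lmean h θ' ∂(Measure.pi fun _ : Fin M => m.mixture K z θ) =
      lmean (fun x => ENNReal.ofReal (m.trans (pre z) (lastPair z) x) *
        ∫⁻ y, h y ∂K (t + 1) (z, x)) θ := by
  have hnn := m.trans_nonneg (pre z) (lastPair z)
  rcases (Finset.sum_nonneg fun j (_ : j ∈ Finset.univ) => hnn (θ j)).eq_or_lt with h0 | h0
  · have h1 : ∀ j, m.trans (pre z) (lastPair z) (θ j) = 0 := fun j =>
      (Finset.sum_eq_zero_iff_of_nonneg fun j _ => hnn (θ j)).1 h0.symm j (Finset.mem_univ j)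
    simp [pmean, lmean, h1]
  · have := m.isProbabilityMeasure_mixture K h0
    rw [lintegral_lmean_pi hM _ hh, lintegral_mixture, pmean, lmean,
      ENNReal.ofReal_mul (by positivity), one_div, ENNReal.ofReal_inv_of_pos (by positivity),
      ENNReal.ofReal_natCast, mul_assoc, Finset.mul_sum]
    congr 1
    refine Finset.sum_congr rfl fun j _ => ?_
    rw [← mul_assoc, ← ENNReal.ofReal_mul h0.le, ibisWeight, mul_div_cancel₀ _ h0.ne']

end Markov

/-- The likelihood times the prior is the evidence times the posterior, so it inherits invariance.
Where the policy product is zero the likelihood vanishes. -/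
lemma lintegral_likelihood_mul_eq_of_invariant (hf : m.PosBounded) {t : ℕ} {z : Hist X Ξ t}
    {κ : Kernel Θ Θ} (hκ : Kernel.Invariant κ (m.posterior z)) {h : Θ → ENNReal}
    (hh : Measurable h) :
    ∫⁻ θ, ENNReal.ofReal (m.likelihood z θ) * ∫⁻ x, h x ∂κ θ ∂m.prior =
      ∫⁻ θ, ENNReal.ofReal (m.likelihood z θ) * h θ ∂m.prior := by
  rcases (m.policyProd_nonneg z).eq_or_lt with h0 | h0
  · simp [m.likelihood_eq_zero z h0.symm]
  have he := hf.evidence_pos h0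
  have hlik : ∀ g : Θ → ENNReal, Measurable g →
      ∫⁻ θ, ENNReal.ofReal (m.likelihood z θ) * g θ ∂m.prior =
        ENNReal.ofReal (m.evidence z) * ∫⁻ θ, g θ ∂m.posterior z := by
    intro g hg
    have hd : Measurable (m.postDensity z) := m.measurable_postDensity.comp measurable_prodMk_left
    rw [m.lintegral_posterior z hg,
      ← lintegral_const_mul (f := fun θ => ENNReal.ofReal (m.postDensity z θ) * g θ) _
        (hd.ennreal_ofReal.mul hg)]
    refine lintegral_congr fun θ => ?_
    rw [← mul_assoc, ← ENNReal.ofReal_mul he.le, postDensity, ← evidence,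
      mul_div_cancel₀ _ he.ne']
  rw [hlik _ hh.lintegral_kernel, hlik _ hh, ← Measure.lintegral_bind κ.aemeasurable
    hh.aemeasurable, hκ]

/-- Unbiasedness of the particle approximation of the unnormalized posterior. -/
lemma lintegral_predProd_mul_lmean [∀ s, IsMarkovKernel (K s)] (hf : m.PosBounded) (hM : M ≠ 0) :
    {t : ℕ} → (hK : ∀ s, 1 ≤ s → s ≤ t → ∀ z : Hist X Ξ s,
      Kernel.Invariant ((K s).sectR z) (m.posterior z)) → (z : Hist X Ξ t) → {h : Θ → ENNReal} →
    (hh : Measurable h) →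
    ∫⁻ p, ENNReal.ofReal (m.predProd z p.1) * lmean h (p.1 (Fin.last t)) ∂m.ibisLaw K M z =
      ∫⁻ θ, ENNReal.ofReal (m.likelihood z θ) * h θ ∂m.prior
  | 0, hK, z, h, hh => by
    simp only [predProd, likelihood, ENNReal.ofReal_one, one_mul]
    rw [m.lintegral_ibisLaw_zero K z (M := M) (g := fun e => lmean h (e (Fin.last 0))) ((measurable_lmean hh).comp (measurable_pi_apply _)),
      lintegral_lmean_pi hM _ hh]
  | t + 1, hK, z, h, hh => by
    have hm1 : Measurable fun e : Fin (t + 2) → Fin M → Θ => ENNReal.ofReal (m.predProd z e) :=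
      (m.measurable_predProd.comp measurable_prodMk_left).ennreal_ofReal
    have hm2 : Measurable fun e : Fin (t + 2) → Fin M → Θ => lmean h (e (Fin.last (t + 1))) :=
      (measurable_lmean hh).comp (measurable_pi_apply _)
    have hv := (m.measurable_trans (pre z) (lastPair z)).ennreal_ofReal
    have hk : Measurable fun x => ∫⁻ y, h y ∂(K (t + 1)).sectR z x := hh.lintegral_kernel
    rw [m.lintegral_ibisLaw_succ K z (g := fun e => ENNReal.ofReal (m.predProd z e) *
      lmean h (e (Fin.last (t + 1)))) (hm1.mul hm2)]
    -- Invariance inserts the mutation kernel on the right-hand side. The last transition density is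
    -- then split off the likelihood, so that the induction hypothesis applies to this density times
    -- the mutated test function.
    rw [← m.lintegral_likelihood_mul_eq_of_invariant hf (hK (t + 1) (by omega) le_rfl z) hh]
    have hl : ∀ θ, ENNReal.ofReal (m.likelihood z θ) * ∫⁻ x, h x ∂(K (t + 1)).sectR z θ =
        ENNReal.ofReal (m.likelihood (pre z) θ) * (ENNReal.ofReal
          (m.trans (pre z) (lastPair z) θ) * ∫⁻ x, h x ∂(K (t + 1)).sectR z θ) := fun θ => by
      rw [likelihood, ENNReal.ofReal_mul (m.likelihood_nonneg _ _), mul_assoc]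
    simp_rw [hl]
    rw [← lintegral_predProd_mul_lmean hf hM (fun s h1 h2 => hK s h1 (by omega)) (pre z)
      (h := fun x => ENNReal.ofReal (m.trans (pre z) (lastPair z) x) *
        ∫⁻ y, h y ∂(K (t + 1)).sectR z x) (hv.mul hk)]
    refine lintegral_congr fun p => ?_
    simp only [predProd, Fin.init_snoc, Fin.snoc_last]
    rw [lintegral_const_mul _ (measurable_lmean hh), ENNReal.ofReal_mul (m.predProd_nonneg _ _),
      mul_assoc, m.ofReal_pmean_mul_lintegral_pi_mixture K hM z _ hh]
    simp [Kernel.sectR_apply]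

lemma lintegral_predProd [∀ s, IsMarkovKernel (K s)] (hf : m.PosBounded) (hM : M ≠ 0) {t : ℕ}
    (hK : ∀ s, 1 ≤ s → s ≤ t → ∀ z : Hist X Ξ s,
      Kernel.Invariant ((K s).sectR z) (m.posterior z)) (z : Hist X Ξ t) :
    ∫⁻ p, ENNReal.ofReal (m.predProd z p.1) ∂m.ibisLaw K M z =
      ENNReal.ofReal (m.evidence z) := by
  have h := m.lintegral_predProd_mul_lmean K hf hM hK z (h := fun _ => 1) measurable_const
  simp only [lmean_const hM, mul_one] at h
  rw [h, hf.ofReal_evidence]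

end Model

end SeqDesign

/-! ### Laws of large numbers along a fixed history -/

namespace SeqDesign

variable {X Ξ Θ : Type*} [MeasurableSpace X] [MeasurableSpace Ξ] [MeasurableSpace Θ]

/-- The weak law of large numbers in `L¹`, with a rate, for a bounded function. -/
lemma lintegral_enorm_pmean_sub_le {M : ℕ} (hM : M ≠ 0) (ν : Measure Θ) [IsProbabilityMeasure ν]
    {h : Θ → ℝ} (hh : Measurable h) {C : ℝ} (hC : ∀ θ, |h θ| ≤ C) :
    ∫⁻ θ, ‖pmean h θ - ∫ x, h x ∂ν‖ₑ ∂(Measure.pi fun _ : Fin M => ν) ≤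
      ENNReal.ofReal (C ^ 2 / M) ^ (1 / 2 : ℝ) := by
  set μ := Measure.pi fun _ : Fin M => ν
  have hL : MemLp h 2 ν := MemLp.of_bound hh.aestronglyMeasurable C (ae_of_all _ hC)
  have hmp := measurePreserving_eval fun _ : Fin M => ν
  have hLi : ∀ i : Fin M, MemLp (fun θ : Fin M → Θ => h (θ i)) 2 μ := fun i =>
    hL.comp_measurePreserving (hmp i)
  have hint : ∫ θ, pmean h θ ∂μ = ∫ x, h x ∂ν := by
    have : ∀ i : Fin M, ∫ θ : Fin M → Θ, h (θ i) ∂μ = ∫ x, h x ∂ν := fun i => by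
      rw [← (hmp i).map_eq, integral_map (hmp i).aemeasurable hh.aestronglyMeasurable]
    simp only [pmean]
    rw [integral_const_mul, integral_finsetSum _ fun i _ => (hLi i).integrable one_le_two]
    simp only [this, Finset.sum_const, Finset.card_univ, Fintype.card_fin, nsmul_eq_mul]
    field_simp
  have hPL : MemLp (pmean h : (Fin M → Θ) → ℝ) 2 μ :=
    (memLp_finsetSum _ fun i _ => hLi i).const_mul _
  have hvar : Var[pmean h; μ] ≤ C ^ 2 / M := by
    have h1 : Var[h; ν] ≤ C ^ 2 := by
      have := variance_le_sq_of_bounded (μ := ν) (a := -C) (b := C)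
        (ae_of_all _ fun x => abs_le.1 (hC x)) hh.aemeasurable
      calc _ ≤ _ := this
        _ = C ^ 2 := by ring
    have h2 := variance_sum_pi (ι := Fin M) (μ := fun _ => ν) (X := fun _ => h) fun _ => hL
    have h3 : Var[pmean h; μ] = (1 / (M : ℝ)) ^ 2 * Var[∑ i : Fin M, fun θ => h (θ i); μ] := by
      rw [← variance_const_mul]
      congr 1
      ext θ
      simp [pmean]
    rw [h3, h2, Finset.sum_const, Finset.card_univ, Fintype.card_fin, nsmul_eq_mul]
    have hM' : (0 : ℝ) < M := by positivity
    calc (1 / (M : ℝ)) ^ 2 * (M * Var[h; ν]) = Var[h; ν] / M := by field_simp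
      _ ≤ C ^ 2 / M := by gcongr
  have hmeas : Measurable fun θ : Fin M → Θ => ‖pmean h θ - ∫ x, h x ∂ν‖ₑ :=
    ((measurable_pmean hh).sub_const _).enorm
  -- Cauchy–Schwarz against the constant 1 bounds the $L^1$ error by the standard deviation.
  have hH := ENNReal.lintegral_mul_norm_pow_le (μ := μ) (hmeas.pow_const 2).aemeasurable
    (g := fun _ => 1) aemeasurable_const (p := 1 / 2) (q := 1 / 2) (by norm_num) (by norm_num)
    (by norm_num)
  calc _ = ∫⁻ θ, (‖pmean h θ - ∫ x, h x ∂ν‖ₑ ^ 2) ^ (1 / 2 : ℝ) * 1 ^ (1 / 2 : ℝ) ∂μ := by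
        refine lintegral_congr fun θ => ?_
        rw [ENNReal.one_rpow, mul_one, ← ENNReal.rpow_natCast, ← ENNReal.rpow_mul]
        norm_num
    _ ≤ _ := hH
    _ = ENNReal.ofReal Var[pmean h; μ] ^ (1 / 2 : ℝ) := by
        rw [ofReal_variance hPL, evariance, hint]
        simp
    _ ≤ _ := by gcongr

lemma tendsto_ofReal_div_natCast_rpow (c : ℝ) :
    Tendsto (fun M : ℕ => ENNReal.ofReal (c / M) ^ (1 / 2 : ℝ)) atTop (𝓝 0) := by
  have h1 : Tendsto (fun M : ℕ => ENNReal.ofReal (c / M)) atTop (𝓝 0) := by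
    simpa using ENNReal.tendsto_ofReal (tendsto_const_div_atTop_nhds_zero_nat c)
  have h2 := (ENNReal.continuous_rpow_const (y := 1 / 2)).tendsto 0
  rw [ENNReal.zero_rpow_of_pos (by norm_num)] at h2
  exact h2.comp h1

omit [MeasurableSpace Θ] in
lemma pmean_le {M : ℕ} {g : Θ → ℝ} {C : ℝ} (hC : 0 ≤ C) (hg : ∀ θ, g θ ≤ C) (θ : Fin M → Θ) :
    pmean g θ ≤ C := by
  rcases eq_or_ne M 0 with rfl | hM
  · simpa [pmean] using hC
  · have h1 : ∑ i, g (θ i) ≤ M * C := by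
      simpa using Finset.sum_le_card_nsmul Finset.univ (fun i => g (θ i)) C fun i _ => hg _
    calc pmean g θ ≤ (1 / (M : ℝ)) * (M * C) := by unfold pmean; gcongr
      _ = C := by field_simp

omit [MeasurableSpace Θ] in
lemma pmean_pos {M : ℕ} (hM : M ≠ 0) {g : Θ → ℝ} (hg : ∀ θ, 0 < g θ) (θ : Fin M → Θ) :
    0 < pmean g θ := by
  have : NeZero M := ⟨hM⟩
  exact mul_pos (by positivity) (Finset.sum_pos (fun i _ => hg _) Finset.univ_nonempty)

/-- The random denominator `B` needs no lower bound uniform in the particles: the error is written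
with the ratio `A / B`, a mixture mean bounded by `C`, and with the fixed limit `b`. -/
lemma enorm_div_sub_div_le {A B a b C : ℝ} (hB : 0 < B) (hb : 0 < b) (hAB : |A / B| ≤ C) :
    ‖A / B - a / b‖ₑ ≤ ENNReal.ofReal (1 / b) * ‖A - a‖ₑ + ENNReal.ofReal (C / b) * ‖B - b‖ₑ := by
  have hC : 0 ≤ C := (abs_nonneg _).trans hAB
  have e : A / B - a / b = 1 / b * (A - a) - A / B * (1 / b) * (B - b) := by field_simp; ring
  rw [Real.enorm_eq_ofReal_abs, Real.enorm_eq_ofReal_abs, Real.enorm_eq_ofReal_abs,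
    ← ENNReal.ofReal_mul (by positivity), ← ENNReal.ofReal_mul (by positivity),
    ← ENNReal.ofReal_add (by positivity) (by positivity)]
  refine ENNReal.ofReal_le_ofReal ?_
  rw [e]
  refine (abs_sub _ _).trans ?_
  rw [abs_mul, abs_mul, abs_mul, abs_of_pos (one_div_pos.2 hb)]
  have : |A / B| * (1 / b) ≤ C / b := by
    rw [div_eq_mul_one_div C]
    gcongr
  gcongr

lemma enorm_mul_sub_mul_le {x y a b C D : ℝ} (hb : |y| ≤ C) (hD : |a| ≤ D) :
    ‖x * y - a * b‖ₑ ≤ ENNReal.ofReal C * ‖x - a‖ₑ + ENNReal.ofReal D * ‖y - b‖ₑ := by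
  have hC : 0 ≤ C := (abs_nonneg _).trans hb
  have hD' : 0 ≤ D := (abs_nonneg _).trans hD
  rw [Real.enorm_eq_ofReal_abs, Real.enorm_eq_ofReal_abs, Real.enorm_eq_ofReal_abs,
    ← ENNReal.ofReal_mul (by positivity), ← ENNReal.ofReal_mul (by positivity),
    ← ENNReal.ofReal_add (by positivity) (by positivity)]
  refine ENNReal.ofReal_le_ofReal ?_
  have e : x * y - a * b = y * (x - a) + a * (y - b) := by ring
  rw [e]
  refine (abs_add_le _ _).trans ?_
  rw [abs_mul, abs_mul]
  gcongr

/-- Near `e` continuity gives `ε`; at distance at least `δ` a bounded difference is at most a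
multiple of the distance. This turns $L^1$ convergence of `x` into that of `φ x` without a Lipschitz
condition. -/
lemma exists_abs_sub_le_add_mul {φ : ℝ → ℝ} {e : ℝ} (hφ : ContinuousAt φ e) (D : ℝ) {ε : ℝ}
    (hε : 0 < ε) : ∃ c, 0 ≤ c ∧ ∀ x, |φ x| ≤ D → |φ x - φ e| ≤ ε + c * |x - e| := by
  obtain ⟨δ, hδ, h⟩ := Metric.continuousAt_iff.1 hφ ε hε
  refine ⟨(|D| + |φ e|) / δ, by positivity, fun x hx => ?_⟩
  by_cases hxe : |x - e| < δ
  · have := h hxe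
    rw [Real.dist_eq] at this
    have : 0 ≤ (|D| + |φ e|) / δ * |x - e| := by positivity
    linarith
  · have h1 : 1 ≤ |x - e| / δ := (one_le_div hδ).2 (not_lt.1 hxe)
    calc |φ x - φ e| ≤ |φ x| + |φ e| := abs_sub _ _
      _ ≤ |D| + |φ e| := add_le_add_left (hx.trans (le_abs_self D)) _
      _ ≤ (|D| + |φ e|) * (|x - e| / δ) := le_mul_of_one_le_right (by positivity) h1
      _ = (|D| + |φ e|) / δ * |x - e| := by ring
      _ ≤ _ := by linarith

namespace Model

variable (m : Model X Ξ Θ) (K : (s : ℕ) → Kernel (Hist X Ξ s × Θ) Θ) [∀ s, IsMarkovKernel (K s)]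

/-- The kernels leave the posteriors invariant up to time `t`. -/
def InvariantUpTo (t : ℕ) : Prop :=
  ∀ s, 1 ≤ s → s ≤ t → ∀ z : Hist X Ξ s, Kernel.Invariant ((K s).sectR z) (m.posterior z)

variable {m K}

omit [∀ s, IsMarkovKernel (K s)] in
lemma InvariantUpTo.of_succ {t : ℕ} (h : m.InvariantUpTo K (t + 1)) : m.InvariantUpTo K t :=
  fun s h1 h2 => h s h1 (h2.trans t.le_succ)

lemma integral_mixture {M t : ℕ} (z : Hist X Ξ (t + 1)) (θ : Fin M → Θ) {h : Θ → ℝ}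
    (hh : Measurable h) {C : ℝ} (hC : ∀ θ, |h θ| ≤ C) :
    ∫ x, h x ∂m.mixture K z θ =
      pmean (fun x => m.trans (pre z) (lastPair z) x * ∫ y, h y ∂K (t + 1) (z, x)) θ /
        pmean (m.trans (pre z) (lastPair z)) θ := by
  rcases eq_or_ne M 0 with rfl | hM
  · simp [mixture, pmean]
  have hi : ∀ x : Θ, Integrable h (K (t + 1) (z, x)) := fun x =>
    Integrable.of_bound hh.aestronglyMeasurable C (ae_of_all _ hC)
  rw [mixture, integral_finsetSum_measure fun i _ => (hi _).smul_measure ENNReal.ofReal_ne_top]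
  simp only [integral_smul_measure, ENNReal.toReal_ofReal (m.ibisWeight_nonneg _ _ _), pmean,
    smul_eq_mul]
  simp only [ibisWeight]
  rw [mul_div_mul_left _ _ (by positivity), Finset.sum_div]
  exact Finset.sum_congr rfl fun i _ => by ring

/-- Reweighting the old posterior by the last transition density is Bayes' rule, and the mutation
kernel leaves the result invariant. The left-hand side is the limit of the mixture means of one IBIS
step. -/
lemma integral_posterior_update (hf : m.PosBounded) {t : ℕ} {z : Hist X Ξ (t + 1)}
    (hz : 0 < m.policyProd z) (hK : m.InvariantUpTo K (t + 1)) {h : Θ → ℝ}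
    (hh : Measurable h) {C : ℝ} (hC : ∀ θ, |h θ| ≤ C) :
    (∫ θ, m.trans (pre z) (lastPair z) θ * ∫ y, h y ∂K (t + 1) (z, θ) ∂m.posterior (pre z)) /
      (∫ θ, m.trans (pre z) (lastPair z) θ ∂m.posterior (pre z)) = ∫ θ, h θ ∂m.posterior z := by
  have hz' := ((m.policyProd_pos_iff z).1 hz).1
  have e1 := hf.evidence_pos hz'
  have e2 := hf.evidence_pos hz
  have := hf.isProbabilityMeasure_posterior hz
  have hinv : ∫ θ, h θ ∂m.posterior z =
      ∫ θ, ∫ y, h y ∂(K (t + 1)).sectR z θ ∂m.posterior z := by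
    -- Reading the composition as the second marginal of a joint law makes Fubini available for the
    -- Bochner integral.
    conv_lhs => rw [← hK (t + 1) (by omega) le_rfl z, ← Measure.snd_compProd, Measure.snd]
    rw [integral_map measurable_snd.aemeasurable hh.aestronglyMeasurable]
    exact Measure.integral_compProd (Integrable.of_bound
      (hh.comp measurable_snd).aestronglyMeasurable C (ae_of_all _ fun _ => hC _))
  rw [hinv, m.integral_posterior z, m.integral_posterior (pre z), m.integral_posterior (pre z),
    div_div_div_cancel_right₀ e1.ne']
  simp only [likelihood, Kernel.sectR_apply, mul_assoc]
  rfl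

omit [∀ s, IsMarkovKernel (K s)] in
lemma measurable_integral_kernel {t : ℕ} (z : Hist X Ξ t) {h : Θ → ℝ} (hh : Measurable h) :
    Measurable fun x => ∫ y, h y ∂K t (z, x) :=
  (hh.stronglyMeasurable.integral_kernel (κ := (K t).sectR z)).measurable

lemma abs_integral_le_of_abs_le {ν : Measure Θ} [IsProbabilityMeasure ν] {h : Θ → ℝ} {C : ℝ}
    (hC : ∀ θ, |h θ| ≤ C) : |∫ x, h x ∂ν| ≤ C := by
  simpa using norm_integral_le_of_norm_le_const (μ := ν) (f := h) (ae_of_all _ hC)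

/-- The law of large numbers for IBIS along a fixed history. -/
theorem tendsto_lintegral_enorm_pmean_sub (hf : m.PosBounded) : {t : ℕ} →
    m.InvariantUpTo K t → {z : Hist X Ξ t} → 0 < m.policyProd z → {h : Θ → ℝ} → Measurable h →
    {C : ℝ} → (∀ θ, |h θ| ≤ C) →
    Tendsto (fun M => ∫⁻ p, ‖pmean h (p.1 (Fin.last t)) - ∫ θ, h θ ∂m.posterior z‖ₑ
      ∂m.ibisLaw K M z) atTop (𝓝 0)
  | 0, _, z, _, h, hh, C, hC => by
    have hpost : ∫ θ, h θ ∂m.posterior z = ∫ θ, h θ ∂m.prior := by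
      rw [integral_posterior]
      simp [likelihood, evidence]
    refine tendsto_of_tendsto_of_tendsto_of_le_of_le' tendsto_const_nhds
      (tendsto_ofReal_div_natCast_rpow (C ^ 2)) (Eventually.of_forall fun _ => zero_le) ?_
    filter_upwards [eventually_ne_atTop 0] with M hM
    rw [m.lintegral_ibisLaw_zero K z (M := M)
      (g := fun e => ‖pmean h (e (Fin.last 0)) - ∫ θ, h θ ∂m.posterior z‖ₑ)
      (((measurable_pmean hh).comp (measurable_pi_apply _)).sub_const _).enorm, hpost]
    exact lintegral_enorm_pmean_sub_le hM _ hh hC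
  | t + 1, hK, z, hz, h, hh, C, hC => by
    obtain ⟨hz1, hz2⟩ := (m.policyProd_pos_iff z).1 hz
    have := hf.isProbabilityMeasure_posterior hz1
    set v := m.trans (pre z) (lastPair z)
    have hv : Measurable v := m.measurable_trans _ _
    have hvpos : ∀ θ, 0 < v θ := hf.trans_pos _ _ hz2
    obtain ⟨D, hD⟩ := hf.trans_le (pre z) (lastPair z)
    have hvD : ∀ θ, |v θ| ≤ D := fun θ => by rw [abs_of_pos (hvpos θ)]; exact hD θ
    set k : Θ → ℝ := fun x => ∫ y, h y ∂K (t + 1) (z, x)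
    have hk : Measurable k := measurable_integral_kernel z hh
    have hkC : ∀ θ, |k θ| ≤ C := fun θ => abs_integral_le_of_abs_le hC
    have hvk : ∀ θ, |v θ * k θ| ≤ D * C := fun θ => by
      rw [abs_mul]
      exact mul_le_mul (hvD θ) (hkC θ) (abs_nonneg _) ((abs_nonneg _).trans (hvD θ))
    have ih1 := tendsto_lintegral_enorm_pmean_sub hf hK.of_succ hz1 (h := fun θ => v θ * k θ)
      (hv.mul hk) hvk
    have ih2 := tendsto_lintegral_enorm_pmean_sub hf hK.of_succ hz1 hv hvD
    set a := ∫ θ, v θ * k θ ∂m.posterior (pre z) with ha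
    set b := ∫ θ, v θ ∂m.posterior (pre z) with hb
    have hbpos : 0 < b := by
      rw [hb, integral_pos_iff_support_of_nonneg (fun θ => (hvpos θ).le)
        (Integrable.of_bound hv.aestronglyMeasurable D (ae_of_all _ hvD)),
        Function.support_eq_univ fun θ => (hvpos θ).ne']
      simp
    have hab : a / b = ∫ θ, h θ ∂m.posterior z := integral_posterior_update hf hz hK hh hC
    -- Three errors: the sampling noise of the new particles given the old ones, and the errors of
    -- the numerator and denominator of the mixture mean, both covered by the induction hypothesis.
    have hlim := ((tendsto_ofReal_div_natCast_rpow (C ^ 2)).add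
      (ENNReal.Tendsto.const_mul ih1 (.inr (ENNReal.ofReal_ne_top (r := 1 / b))))).add
      (ENNReal.Tendsto.const_mul ih2 (.inr (ENNReal.ofReal_ne_top (r := C / b))))
    simp only [mul_zero, add_zero] at hlim
    refine tendsto_of_tendsto_of_tendsto_of_le_of_le' tendsto_const_nhds hlim
      (Eventually.of_forall fun _ => zero_le) ?_
    filter_upwards [eventually_ne_atTop 0] with M hM
    rw [m.lintegral_ibisLaw_succ K z (M := M)
      (g := fun e => ‖pmean h (e (Fin.last (t + 1))) - ∫ θ, h θ ∂m.posterior z‖ₑ)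
      (((measurable_pmean hh).comp (measurable_pi_apply _)).sub_const _).enorm, ← hab]
    simp only [Fin.snoc_last]
    have hmA : Measurable fun p : Part Θ M t =>
        ‖pmean (fun θ => v θ * k θ) (p.1 (Fin.last t)) - a‖ₑ :=
      (((measurable_pmean (hv.mul hk)).comp
        ((measurable_pi_apply (Fin.last t)).comp measurable_fst)).sub_const _).enorm
    have hmB : Measurable fun p : Part Θ M t => ‖pmean v (p.1 (Fin.last t)) - b‖ₑ :=
      (((measurable_pmean hv).comp
        ((measurable_pi_apply (Fin.last t)).comp measurable_fst)).sub_const _).enorm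
    calc _ ≤ ∫⁻ p, (ENNReal.ofReal (C ^ 2 / M) ^ (1 / 2 : ℝ) +
          ENNReal.ofReal (1 / b) * ‖pmean (fun θ => v θ * k θ) (p.1 (Fin.last t)) - a‖ₑ) +
          ENNReal.ofReal (C / b) * ‖pmean v (p.1 (Fin.last t)) - b‖ₑ
            ∂m.ibisLaw K M (pre z) := by
          refine lintegral_mono fun p => ?_
          have hB : 0 < pmean v (p.1 (Fin.last t)) := pmean_pos hM hvpos _
          have hS : 0 < ∑ j, v (p.1 (Fin.last t) j) := pos_of_mul_pos_right hB (by positivity)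
          have := m.isProbabilityMeasure_mixture K hS
          have hmix := integral_mixture (m := m) (K := K) z (p.1 (Fin.last t)) hh hC
          have hle := lintegral_enorm_pmean_sub_le hM (m.mixture K z (p.1 (Fin.last t))) hh hC
          have hA := abs_integral_le_of_abs_le (ν := m.mixture K z (p.1 (Fin.last t))) hC
          rw [hmix] at hA
          rw [add_assoc]
          calc _ ≤ ∫⁻ θ, (‖pmean h θ - ∫ x, h x ∂m.mixture K z (p.1 (Fin.last t))‖ₑ +
                ‖∫ x, h x ∂m.mixture K z (p.1 (Fin.last t)) - a / b‖ₑ)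
                ∂(Measure.pi fun _ : Fin M => m.mixture K z (p.1 (Fin.last t))) := by
                refine lintegral_mono fun θ => ?_
                rw [← sub_add_sub_cancel (pmean h θ)
                  (∫ x, h x ∂m.mixture K z (p.1 (Fin.last t))) (a / b)]
                exact enorm_add_le _ _
            _ ≤ _ := by
                rw [lintegral_add_right _ measurable_const, lintegral_const, measure_univ, mul_one]
                refine add_le_add hle ?_
                rw [hmix]
                exact enorm_div_sub_div_le hB hbpos hA
      _ ≤ _ := by
          rw [lintegral_add_right _ (hmB.const_mul _), lintegral_add_right _ (hmA.const_mul _),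
            lintegral_const_mul _ hmA, lintegral_const_mul _ hmB, lintegral_const]
          gcongr
          exact mul_le_of_le_one_right' (m.ibisLaw_univ_le K _)

/-- The predictive density estimates converge along a fixed history. -/
theorem tendsto_lintegral_enorm_predProd_sub (hf : m.PosBounded) : {t : ℕ} →
    m.InvariantUpTo K t → {z : Hist X Ξ t} → 0 < m.policyProd z →
    Tendsto (fun M => ∫⁻ p, ‖m.predProd z p.1 - m.evidence z‖ₑ ∂m.ibisLaw K M z) atTop (𝓝 0)
  | 0, _, z, _ => by simp [predProd, evidence, likelihood]
  | t + 1, hK, z, hz => by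
    obtain ⟨hz1, hz2⟩ := (m.policyProd_pos_iff z).1 hz
    set v := m.trans (pre z) (lastPair z)
    have hv : Measurable v := m.measurable_trans _ _
    have hvpos : ∀ θ, 0 < v θ := hf.trans_pos _ _ hz2
    obtain ⟨D, hD⟩ := hf.trans_le (pre z) (lastPair z)
    have hvD : ∀ θ, |v θ| ≤ D := fun θ => by rw [abs_of_pos (hvpos θ)]; exact hD θ
    have hD0 : 0 ≤ D := by
      obtain ⟨θ⟩ := m.prior.nonempty_of_neZero
      exact (abs_nonneg _).trans (hvD θ)
    have ih1 := tendsto_lintegral_enorm_predProd_sub hf hK.of_succ hz1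
    have ih2 := tendsto_lintegral_enorm_pmean_sub hf hK.of_succ hz1 hv hvD
    set b := ∫ θ, v θ ∂m.posterior (pre z) with hb
    have hev : m.evidence z = m.evidence (pre z) * b := by
      have := PosBounded.margTrans_eq (m := m) z
      rw [margTrans] at this
      rw [hb, this, mul_div_cancel₀ _ (hf.evidence_pos hz1).ne']
    have hlim := (ENNReal.Tendsto.const_mul ih1 (.inr (ENNReal.ofReal_ne_top (r := D)))).add
      (ENNReal.Tendsto.const_mul ih2 (.inr (ENNReal.ofReal_ne_top (r := m.evidence (pre z)))))
    simp only [mul_zero, add_zero] at hlim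
    refine tendsto_of_tendsto_of_tendsto_of_le_of_le' tendsto_const_nhds hlim
      (Eventually.of_forall fun _ => zero_le) ?_
    filter_upwards [eventually_ne_atTop 0] with M hM
    rw [m.lintegral_ibisLaw_succ K z (M := M) (g := fun e => ‖m.predProd z e - m.evidence z‖ₑ)
      ((m.measurable_predProd.comp measurable_prodMk_left).sub_const _).enorm]
    have hmA : Measurable fun p : Part Θ M t => ‖m.predProd (pre z) p.1 - m.evidence (pre z)‖ₑ :=
      ((m.measurable_predProd.comp
        (measurable_const.prodMk measurable_fst)).sub_const _).enorm
    have hmB : Measurable fun p : Part Θ M t => ‖pmean v (p.1 (Fin.last t)) - b‖ₑ :=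
      (((measurable_pmean hv).comp
        ((measurable_pi_apply (Fin.last t)).comp measurable_fst)).sub_const _).enorm
    rw [← lintegral_const_mul _ hmA, ← lintegral_const_mul _ hmB,
      ← lintegral_add_right _ (hmB.const_mul _)]
    refine lintegral_mono fun p => ?_
    have hB : 0 < pmean v (p.1 (Fin.last t)) := pmean_pos hM hvpos _
    have hS : 0 < ∑ j, v (p.1 (Fin.last t) j) := pos_of_mul_pos_right hB (by positivity)
    have := m.isProbabilityMeasure_mixture K hS
    -- The product at time `t + 1` does not involve the newest particles, so their law integrates to
    -- one.
    simp only [predProd, Fin.init_snoc, lintegral_const, measure_univ, mul_one, hev]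
    refine enorm_mul_sub_mul_le ?_ (abs_of_nonneg (m.evidence_nonneg _)).le
    rw [abs_of_pos hB]
    exact pmean_le hD0 hD _

end Model

end SeqDesign

/-! ### Weights of the algorithm: normalization, domination and limit at a fixed history -/

namespace SeqDesign

variable {X Ξ Θ : Type*} [MeasurableSpace X] [MeasurableSpace Ξ] [MeasurableSpace Θ]

lemma tendsto_lintegral_ofReal_of_enorm_sub {ι : Type*} {l : Filter ι} {α : ι → Type*}
    [∀ i, MeasurableSpace (α i)] {μ : ∀ i, Measure (α i)} {F : ∀ i, α i → ℝ} {c : ℝ}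
    (hμ : ∀ᶠ i in l, IsProbabilityMeasure (μ i)) (hF : ∀ᶠ i in l, Measurable (F i))
    (h : Tendsto (fun i => ∫⁻ a, ‖F i a - c‖ₑ ∂μ i) l (𝓝 0)) :
    Tendsto (fun i => ∫⁻ a, ENNReal.ofReal (F i a) ∂μ i) l (𝓝 (ENNReal.ofReal c)) := by
  have h1 := ENNReal.Tendsto.sub (tendsto_const_nhds (x := ENNReal.ofReal c)) h
    (.inl ENNReal.ofReal_ne_top)
  have h2 := (tendsto_const_nhds (x := ENNReal.ofReal c)).add h
  rw [tsub_zero] at h1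
  rw [add_zero] at h2
  have key : ∀ x y : ℝ, ENNReal.ofReal x ≤ ENNReal.ofReal y + ‖x - y‖ₑ := fun x y => by
    rw [Real.enorm_eq_ofReal_abs]
    calc ENNReal.ofReal x ≤ ENNReal.ofReal (y + |x - y|) :=
          ENNReal.ofReal_le_ofReal (by linarith [le_abs_self (x - y)])
      _ ≤ _ := ENNReal.ofReal_add_le
  refine tendsto_of_tendsto_of_tendsto_of_le_of_le' h1 h2 ?_ ?_
  · filter_upwards [hμ, hF] with i hi hFi
    rw [tsub_le_iff_right, ← lintegral_add_right _ (hFi.sub_const c).enorm]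
    calc ENNReal.ofReal c = ∫⁻ _, ENNReal.ofReal c ∂μ i := by simp
      _ ≤ _ := lintegral_mono fun a => by
          rw [← enorm_neg (F i a - c), neg_sub]
          exact key _ _
  · filter_upwards [hμ] with i hi
    calc _ ≤ ∫⁻ a, (ENNReal.ofReal c + ‖F i a - c‖ₑ) ∂μ i := lintegral_mono fun a => key _ _
      _ = _ := by rw [lintegral_add_left measurable_const]; simp

/-- Shifting by the bound reduces signed test functions to nonnegative ones. -/
lemma integral_eq_toReal_lintegral_sub {α : Type*} [MeasurableSpace α] (μ : Measure α)
    [IsProbabilityMeasure μ] {ψ : α → ℝ} (hψ : Measurable ψ) {C : ℝ} (hC : ∀ a, |ψ a| ≤ C) :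
    ∫ a, ψ a ∂μ = (∫⁻ a, ENNReal.ofReal (ψ a + C) ∂μ).toReal - C := by
  have hi : Integrable ψ μ := Integrable.of_bound hψ.aestronglyMeasurable C (ae_of_all _ hC)
  rw [← integral_eq_lintegral_of_nonneg_ae
    (ae_of_all _ fun a => by have := abs_le.1 (hC a); simp only [Pi.zero_apply]; linarith)
    (hψ.add_const C).aestronglyMeasurable, integral_add hi (integrable_const _)]
  simp

namespace Model

variable (m : Model X Ξ Θ) (K : (s : ℕ) → Kernel (Hist X Ξ s × Θ) Θ)

instance sigmaFinite_lamZ : SigmaFinite m.lamZ := by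
  unfold lamZ
  infer_instance

instance sigmaFinite_histRef (t : ℕ) : SigmaFinite (m.histRef t) := by
  unfold histRef
  infer_instance

lemma lintegral_histRef_succ {t : ℕ} {g : Hist X Ξ (t + 1) → ENNReal} (hg : Measurable g) :
    ∫⁻ z, g z ∂m.histRef (t + 1) = ∫⁻ z, ∫⁻ z', g (append z z') ∂m.lamZ ∂m.histRef t := by
  have hmp := (measurePreserving_piFinSuccAbove (fun _ : Fin (t + 1) => m.lamZ)
    (Fin.last t)).symm
  rw [histRef, histRef, lintegral_prod _ hg.aemeasurable, lintegral_prod _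
    (Measurable.lintegral_prod_right' (f := fun p : Hist X Ξ t × (X × Ξ) => g (append p.1 p.2))
      (hg.comp measurable_append)).aemeasurable]
  refine lintegral_congr fun x => ?_
  have hgx : Measurable fun y => g (x, y) := hg.comp measurable_prodMk_left
  have hge : Measurable fun a => g (x, (MeasurableEquiv.piFinSuccAbove (fun _ => X × Ξ)
      (Fin.last t)).symm a) := hgx.comp (MeasurableEquiv.measurable _)
  rw [← hmp.lintegral_comp hgx, lintegral_prod_symm _ hge.aemeasurable]
  refine lintegral_congr fun y => lintegral_congr fun z' => ?_
  congr 2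
  exact Fin.insertNth_last' z' y

lemma lintegral_trans {t : ℕ} (z : Hist X Ξ t) (θ : Θ) :
    ∫⁻ z', ENNReal.ofReal (m.trans z z' θ) ∂m.lamZ = 1 := by
  have hm : Measurable fun z' : X × Ξ => ENNReal.ofReal (m.trans z z' θ) :=
    (m.measurable_trans_comp measurable_const measurable_id measurable_const).ennreal_ofReal
  rw [lamZ, lintegral_prod_symm _ hm.aemeasurable]
  have : ∀ ξ, ∫⁻ x', ENNReal.ofReal (m.trans z (x', ξ) θ) ∂m.lamX =
      ENNReal.ofReal (m.policy t z ξ) := fun ξ => by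
    simp only [trans, ENNReal.ofReal_mul (m.f_nonneg _ _ _ _)]
    have hx : Measurable fun x' => m.f (lastState z) ξ x' θ :=
      m.measurable_f_comp measurable_const measurable_const measurable_id measurable_const
    rw [lintegral_mul_const _ hx.ennreal_ofReal, m.f_density, one_mul]
  simp only [this, m.policy_density]

lemma lintegral_likelihood (θ : Θ) : (t : ℕ) →
    ∫⁻ z : Hist X Ξ t, ENNReal.ofReal (m.likelihood z θ) ∂m.histRef t = 1
  | 0 => by
    simp only [likelihood, histRef, ENNReal.ofReal_one, lintegral_one]
    rw [← Set.univ_prod_univ, Measure.prod_prod, Measure.pi_univ]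
    simp
  | t + 1 => by
    have hl : Measurable fun z : Hist X Ξ (t + 1) => m.likelihood z θ :=
      m.measurable_likelihood_uncurry.comp measurable_prodMk_right
    rw [m.lintegral_histRef_succ hl.ennreal_ofReal, ← lintegral_likelihood θ t]
    refine lintegral_congr fun z => ?_
    have ht : Measurable fun z' => m.trans z z' θ :=
      m.measurable_trans_comp measurable_const measurable_id measurable_const
    simp only [likelihood, pre_append, lastPair_append,
      ENNReal.ofReal_mul (m.likelihood_nonneg z θ)]
    rw [lintegral_const_mul _ ht.ennreal_ofReal, m.lintegral_trans, mul_one]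

variable {m}

lemma PosBounded.lintegral_evidence (hf : m.PosBounded) (t : ℕ) :
    ∫⁻ z : Hist X Ξ t, ENNReal.ofReal (m.evidence z) ∂m.histRef t = 1 := by
  simp_rw [hf.ofReal_evidence]
  rw [lintegral_lintegral_swap m.measurable_likelihood_uncurry.ennreal_ofReal.aemeasurable]
  simp [lintegral_likelihood]

/-- The evidence integrates to one and vanishes wherever the policy product does. This makes the
normalizing constants nonzero. -/
lemma PosBounded.not_ae_policyProd_eq_zero (hf : m.PosBounded) (t : ℕ) :
    ¬ ∀ᵐ z : Hist X Ξ t ∂m.histRef t, m.policyProd z = 0 := by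
  intro h
  have h1 := hf.lintegral_evidence t
  rw [lintegral_congr_ae (g := fun _ => 0) (h.mono fun z hz => by
    simp [evidence_eq_zero m hz])] at h1
  simp at h1

section Particle

variable {M : ℕ}

lemma updateFactor_eq (hf : m.PosBounded) (hM : M ≠ 0) {t : ℕ} (z : Hist X Ξ t) (z' : X × Ξ)
    (θ : Fin M → Θ) : m.updateFactor z z' θ =
      m.policy t z z'.2 ^ m.η * pmean (m.trans z z') θ ^ (1 - m.η) := by
  obtain ⟨_, _, h⟩ := hf (lastState z) z'.2 z'.1
  have e : pmean (m.trans z z') θ =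
      m.policy t z z'.2 * pmean (m.f (lastState z) z'.2 z'.1) θ := by
    simp only [pmean, trans, ← Finset.sum_mul]
    ring
  have := mul_exp_neg_mul_log m.η_pos (m.policy_nonneg t z z'.2)
    (pmean_pos hM (fun x => (h x).1) θ)
  rw [← e] at this
  exact this

/-- The counterpart of `targetDensity_eq`, with the evidence replaced by its particle estimate. -/
lemma updateProd_eq (hf : m.PosBounded) (hM : M ≠ 0) : {t : ℕ} → (z : Hist X Ξ t) →
    (θ : Fin (t + 1) → Fin M → Θ) →
    m.updateProd z θ = m.policyProd z ^ m.η * m.predProd z θ ^ (1 - m.η)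
  | 0, _, _ => by simp [updateProd, policyProd, predProd]
  | t + 1, z, θ => by
    rw [updateProd, updateProd_eq hf hM (pre z), updateFactor_eq hf hM, policyProd, predProd,
      Real.mul_rpow (m.policyProd_nonneg _) (m.policy_nonneg _ _ _),
      Real.mul_rpow (m.predProd_nonneg _ _) (pmean_nonneg (m.trans_nonneg _ _) _)]
    ring

lemma updateProd_nonneg (hf : m.PosBounded) (hM : M ≠ 0) {t : ℕ} (z : Hist X Ξ t)
    (θ : Fin (t + 1) → Fin M → Θ) : 0 ≤ m.updateProd z θ := by
  rw [updateProd_eq hf hM]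
  exact mul_nonneg (Real.rpow_nonneg (m.policyProd_nonneg _) _)
    (Real.rpow_nonneg (m.predProd_nonneg _ _) _)

lemma measurable_updateProd (hf : m.PosBounded) (hM : M ≠ 0) {t : ℕ} :
    Measurable fun p : Hist X Ξ t × (Fin (t + 1) → Fin M → Θ) => m.updateProd p.1 p.2 := by
  simp_rw [updateProd_eq hf hM]
  exact ((m.measurable_policyProd.comp measurable_fst).pow_const _).mul
    (m.measurable_predProd.pow_const _)

lemma predProd_pos (hf : m.PosBounded) (hM : M ≠ 0) : {t : ℕ} → {z : Hist X Ξ t} →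
    0 < m.policyProd z → (θ : Fin (t + 1) → Fin M → Θ) → 0 < m.predProd z θ
  | 0, _, _, _ => zero_lt_one
  | _ + 1, z, hz, _ => by
    obtain ⟨h1, h2⟩ := (m.policyProd_pos_iff z).1 hz
    exact mul_pos (predProd_pos hf hM h1 _) (pmean_pos hM (hf.trans_pos _ _ h2) _)

lemma updateProd_pos (hf : m.PosBounded) (hM : M ≠ 0) {t : ℕ} {z : Hist X Ξ t}
    (hz : 0 < m.policyProd z) (θ : Fin (t + 1) → Fin M → Θ) : 0 < m.updateProd z θ := by
  rw [updateProd_eq hf hM]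
  exact mul_pos (Real.rpow_pos_of_pos hz _) (Real.rpow_pos_of_pos (predProd_pos hf hM hz θ) _)

lemma updateProd_eq_zero (hf : m.PosBounded) (hM : M ≠ 0) {t : ℕ} {z : Hist X Ξ t}
    (hz : m.policyProd z = 0) (θ : Fin (t + 1) → Fin M → Θ) : m.updateProd z θ = 0 := by
  rw [updateProd_eq hf hM, hz, Real.zero_rpow m.η_pos.ne', zero_mul]

lemma exists_predProd_le (hf : m.PosBounded) : {t : ℕ} → (z : Hist X Ξ t) →
    ∃ D, 0 ≤ D ∧ ∀ (M : ℕ) (θ : Fin (t + 1) → Fin M → Θ), m.predProd z θ ≤ D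
  | 0, _ => ⟨1, zero_le_one, fun _ _ => le_rfl⟩
  | _ + 1, z => by
    obtain ⟨D, hD0, hD⟩ := exists_predProd_le hf (pre z)
    obtain ⟨C, hC⟩ := hf.trans_le (pre z) (lastPair z)
    obtain ⟨θ₀⟩ := m.prior.nonempty_of_neZero
    have hC0 : 0 ≤ C := (m.trans_nonneg _ _ θ₀).trans (hC θ₀)
    exact ⟨D * C, mul_nonneg hD0 hC0, fun M θ => mul_le_mul (hD M _) (pmean_le hC0 hC _)
      (pmean_nonneg (m.trans_nonneg _ _) _) hD0⟩

omit [MeasurableSpace Θ] in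
lemma exists_le_pmean (hM : M ≠ 0) (g : Θ → ℝ) (θ : Fin M → Θ) : ∃ i, g (θ i) ≤ pmean g θ := by
  have : NeZero M := ⟨hM⟩
  obtain ⟨i, -, hi⟩ := Finset.exists_min_image Finset.univ (fun i => g (θ i))
    Finset.univ_nonempty
  refine ⟨i, ?_⟩
  have h1 : M * g (θ i) ≤ ∑ j, g (θ j) := by
    simpa using Finset.card_nsmul_le_sum Finset.univ (fun j => g (θ j)) (g (θ i)) hi
  calc g (θ i) = (1 / (M : ℝ)) * (M * g (θ i)) := by field_simp
    _ ≤ _ := by unfold pmean; gcongr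

lemma weightedDensity_nonneg : {t : ℕ} → (z : Hist X Ξ t) → (θ : Fin t → Θ) →
    0 ≤ m.weightedDensity z θ
  | 0, _, _ => zero_le_one
  | _ + 1, z, _ => mul_nonneg (weightedDensity_nonneg (pre z) _)
      (mul_nonneg (m.trans_nonneg _ _ _) (Real.exp_nonneg _))

/-- At each time some particle has `f` at most the average; since $x\mapsto x^{1-\eta}$ is
decreasing for `1 < η`, putting this particle in place of the average can only increase the factor.
-/
lemma exists_updateProd_le_weightedDensity (hf : m.PosBounded) (hM : M ≠ 0) (hη : 1 < m.η) :
    {t : ℕ} → (z : Hist X Ξ t) → (θ : Fin (t + 1) → Fin M → Θ) →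
    ∃ ϑ : Fin t → Θ, m.updateProd z θ ≤ m.weightedDensity z ϑ
  | 0, _, _ => ⟨Fin.elim0, le_rfl⟩
  | t + 1, z, θ => by
    obtain ⟨ϑ, hϑ⟩ := exists_updateProd_le_weightedDensity hf hM hη (pre z) (Fin.init θ)
    obtain ⟨_, _, h⟩ := hf (lastState (pre z)) (lastPair z).2 (lastPair z).1
    set g := m.f (lastState (pre z)) (lastPair z).2 (lastPair z).1
    set w := Fin.init θ (Fin.last t)
    obtain ⟨i, hi⟩ := exists_le_pmean hM g w
    have hpol := m.policy_nonneg t (pre z) (lastPair z).2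
    have hpm := pmean_pos hM (fun x => (h x).1) w
    refine ⟨Fin.snoc (α := fun _ => Θ) ϑ (w i), ?_⟩
    rw [updateProd, weightedDensity]
    simp only [Fin.init_snoc, Fin.snoc_last]
    refine mul_le_mul hϑ ?_ ?_ (weightedDensity_nonneg _ _)
    · have e1 : m.updateFactor (pre z) (lastPair z) w = m.policy t (pre z) (lastPair z).2 *
          pmean g w ^ (1 - m.η) := by
        have e : (1 / (M : ℝ)) * ∑ i, m.trans (pre z) (lastPair z) (w i) =
            m.policy t (pre z) (lastPair z).2 * pmean g w := by
          simp only [pmean, trans, ← Finset.sum_mul]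
          ring
        rw [updateFactor, e, sub_eq_add_neg, Real.rpow_add hpm, Real.rpow_one,
          Real.rpow_def_of_pos hpm, mul_comm (Real.log _), mul_assoc]
        rfl
      have e2 : m.trans (pre z) (lastPair z) (w i) * Real.exp (-m.η * Real.log (g (w i))) =
          m.policy t (pre z) (lastPair z).2 * g (w i) ^ (1 - m.η) := by
        rw [sub_eq_add_neg, Real.rpow_add (h _).1, Real.rpow_one,
          Real.rpow_def_of_pos (h _).1, mul_comm (Real.log _), trans]
        ring
      rw [e1, e2]
      exact mul_le_mul_of_nonneg_left
        (Real.rpow_le_rpow_of_nonpos (h _).1 hi (by linarith)) hpol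
    · rw [updateFactor_eq hf hM]
      exact mul_nonneg (Real.rpow_nonneg hpol _)
        (Real.rpow_nonneg (pmean_nonneg (m.trans_nonneg _ _) _) _)

end Particle

/-- The potential-weighted densities are dominated by an integrable function. -/
def Dominated (m : Model X Ξ Θ) (t : ℕ) : Prop :=
  ∃ B : Hist X Ξ t → ℝ, Integrable B (m.histRef t) ∧ ∀ z θ, m.weightedDensity z θ ≤ B z

/-- The bound depends on `z` but not on `M`, as needed for convergence at a fixed history. For `η ≤
1` it comes from the boundedness of `f` in the parameter, for `1 < η` from the assumed domination.
-/
lemma exists_updateProd_le (hf : m.PosBounded) {t : ℕ} (hdom : 1 < m.η → m.Dominated t)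
    (z : Hist X Ξ t) :
    ∃ D, ∀ (M : ℕ) (θ : Fin (t + 1) → Fin M → Θ), M ≠ 0 → m.updateProd z θ ≤ D := by
  rcases le_or_gt m.η 1 with hη | hη
  · obtain ⟨D, hD0, hD⟩ := exists_predProd_le hf z
    refine ⟨m.policyProd z ^ m.η * D ^ (1 - m.η), fun M θ hM => ?_⟩
    rw [updateProd_eq hf hM]
    exact mul_le_mul_of_nonneg_left
      (Real.rpow_le_rpow (m.predProd_nonneg _ _) (hD M θ) (by linarith))
      (Real.rpow_nonneg (m.policyProd_nonneg _) _)
  · obtain ⟨B, _, hB⟩ := hdom hη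
    refine ⟨B z, fun M θ hM => ?_⟩
    obtain ⟨ϑ, hϑ⟩ := exists_updateProd_le_weightedDensity hf hM hη z θ
    exact hϑ.trans (hB z ϑ)

variable {K} [∀ s, IsMarkovKernel (K s)]

/-- Jensen's inequality for the concave power `1 - η`, applied to an unbiased estimate of the
evidence. -/
lemma lintegral_updateProd_le_of_le_one (hf : m.PosBounded) {M : ℕ} (hM : M ≠ 0)
    (hη : m.η ≤ 1) {t : ℕ} (hK : m.InvariantUpTo K t) (z : Hist X Ξ t) :
    ∫⁻ p, ENNReal.ofReal (m.updateProd z p.1) ∂m.ibisLaw K M z ≤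
      ENNReal.ofReal (m.targetDensity z) := by
  have hη' : 0 ≤ 1 - m.η := by linarith
  have hm : Measurable fun p : Part Θ M t => m.predProd z p.1 :=
    m.measurable_predProd.comp (measurable_const.prodMk measurable_fst)
  -- Jensen in the form of Hölder with exponents `1 - η` and `η` against the constant 1, for which
  -- total mass at most one suffices.
  have hH := ENNReal.lintegral_mul_norm_pow_le (μ := m.ibisLaw K M z) hm.ennreal_ofReal.aemeasurable
    (g := fun _ => 1) aemeasurable_const (p := 1 - m.η) (q := m.η) hη' m.η_pos.le (by ring)
  rw [m.lintegral_predProd K hf hM hK z] at hH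
  have hP : 0 ≤ m.policyProd z ^ m.η := Real.rpow_nonneg (m.policyProd_nonneg _) _
  simp only [updateProd_eq hf hM, ENNReal.ofReal_mul hP, hf.targetDensity_eq]
  rw [lintegral_const_mul _ (hm.pow_const _).ennreal_ofReal]
  refine mul_le_mul_right ?_ _
  rw [← ENNReal.ofReal_rpow_of_nonneg (m.evidence_nonneg z) hη']
  calc _ = ∫⁻ p, ENNReal.ofReal (m.predProd z p.1) ^ (1 - m.η) * 1 ^ m.η ∂m.ibisLaw K M z := by
        refine lintegral_congr fun p => ?_
        rw [ENNReal.one_rpow, mul_one,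
          ENNReal.ofReal_rpow_of_nonneg (m.predProd_nonneg _ _) hη']
    _ ≤ _ := hH
    _ ≤ _ := by
        refine mul_le_of_le_one_right' ?_
        rw [lintegral_one]
        exact ENNReal.rpow_le_one (m.ibisLaw_univ_le K z) m.η_pos.le

lemma exists_lintegral_updateProd_le (hf : m.PosBounded) {t : ℕ} (hK : m.InvariantUpTo K t)
    (hZ : m.targetZ t < ⊤) (hdom : 1 < m.η → m.Dominated t) :
    ∃ G : Hist X Ξ t → ENNReal, ∫⁻ z, G z ∂m.histRef t < ⊤ ∧ ∀ M : ℕ, M ≠ 0 → ∀ z,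
      ∫⁻ p, ENNReal.ofReal (m.updateProd z p.1) ∂m.ibisLaw K M z ≤ G z := by
  rcases le_or_gt m.η 1 with hη | hη
  · exact ⟨_, hZ, fun M hM z => lintegral_updateProd_le_of_le_one hf hM hη hK z⟩
  · obtain ⟨B, hBi, hB⟩ := hdom hη
    refine ⟨fun z => ENNReal.ofReal (B z), hBi.lintegral_lt_top, fun M hM z => ?_⟩
    calc _ ≤ ∫⁻ _, ENNReal.ofReal (B z) ∂m.ibisLaw K M z := by
          refine lintegral_mono fun p => ENNReal.ofReal_le_ofReal ?_
          obtain ⟨ϑ, hϑ⟩ := exists_updateProd_le_weightedDensity hf hM hη z p.1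
          exact hϑ.trans (hB z ϑ)
      _ ≤ _ := by
          rw [lintegral_const]
          exact mul_le_of_le_one_right' (m.ibisLaw_univ_le K z)

lemma isProbabilityMeasure_ibisLaw (hf : m.PosBounded) {M : ℕ} (hM : M ≠ 0) : {t : ℕ} →
    {z : Hist X Ξ t} → 0 < m.policyProd z → IsProbabilityMeasure (m.ibisLaw K M z)
  | 0, z, _ => ⟨by
      have h := m.lintegral_ibisLaw_zero K z (M := M) (g := fun _ => 1) measurable_const
      simpa using h⟩
  | t + 1, z, hz => ⟨by
      obtain ⟨h1, h2⟩ := (m.policyProd_pos_iff z).1 hz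
      have ih := isProbabilityMeasure_ibisLaw hf hM h1
      have h := m.lintegral_ibisLaw_succ K z (M := M) (g := fun _ => 1) measurable_const
      rw [lintegral_one] at h
      rw [h]
      calc _ = ∫⁻ _, 1 ∂m.ibisLaw K M (pre z) := by
            refine lintegral_congr fun p => ?_
            have hB := pmean_pos hM (hf.trans_pos _ _ h2) (p.1 (Fin.last t))
            have := m.isProbabilityMeasure_mixture K
              (pos_of_mul_pos_right hB (by positivity))
            simp
        _ = 1 := by simp⟩

/-- Convergence of the particle approximation of the target along a fixed history. -/
lemma tendsto_lintegral_updateProd_mul_lmean (hf : m.PosBounded) {t : ℕ}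
    (hK : m.InvariantUpTo K t) (hdom : 1 < m.η → m.Dominated t) (z : Hist X Ξ t) {h : Θ → ℝ}
    (hh : Measurable h) (h0 : ∀ θ, 0 ≤ h θ) {C : ℝ} (hC : ∀ θ, h θ ≤ C) :
    Tendsto (fun M => ∫⁻ p, ENNReal.ofReal (m.updateProd z p.1) *
      lmean (fun θ => ENNReal.ofReal (h θ)) (p.1 (Fin.last t)) ∂m.ibisLaw K M z) atTop
      (𝓝 (ENNReal.ofReal (m.targetDensity z) * ∫⁻ θ, ENNReal.ofReal (h θ) ∂m.posterior z)) := by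
  have hηp := m.η_pos
  rcases (m.policyProd_nonneg z).eq_or_lt with hz | hz
  · have : m.targetDensity z = 0 := by
      rw [hf.targetDensity_eq, ← hz, Real.zero_rpow hηp.ne', zero_mul]
    rw [this, ENNReal.ofReal_zero, zero_mul]
    refine tendsto_const_nhds.congr' ?_
    filter_upwards [eventually_ne_atTop 0] with M hM
    simp [updateProd_eq_zero hf hM hz.symm]
  have := hf.isProbabilityMeasure_posterior hz
  have hC' : ∀ θ, |h θ| ≤ C := fun θ => by rw [abs_of_nonneg (h0 θ)]; exact hC θ
  set φ : ℝ → ℝ := fun x => m.policyProd z ^ m.η * x ^ (1 - m.η)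
  have hφ : ContinuousAt φ (m.evidence z) :=
    continuousAt_const.mul (Real.continuousAt_rpow_const _ _ (.inl (hf.evidence_pos hz).ne'))
  have htd : m.targetDensity z = φ (m.evidence z) := hf.targetDensity_eq z
  have htd0 : 0 ≤ m.targetDensity z := by
    rw [hf.targetDensity_eq]
    exact mul_nonneg (Real.rpow_nonneg hz.le _) (Real.rpow_nonneg (m.evidence_nonneg z) _)
  set μ := ∫ θ, h θ ∂m.posterior z with hμ
  have hμ' : ∫⁻ θ, ENNReal.ofReal (h θ) ∂m.posterior z = ENNReal.ofReal μ :=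
    (ofReal_integral_eq_lintegral_ofReal (Integrable.of_bound hh.aestronglyMeasurable C
      (ae_of_all _ hC')) (ae_of_all _ h0)).symm
  have hmU : ∀ M : ℕ, M ≠ 0 → Measurable fun p : Part Θ M t => m.updateProd z p.1 :=
    fun M hM => (measurable_updateProd hf hM).comp (measurable_const.prodMk measurable_fst)
  have hmH : ∀ M : ℕ, Measurable fun p : Part Θ M t => pmean h (p.1 (Fin.last t)) :=
    fun M => (measurable_pmean hh).comp ((measurable_pi_apply (Fin.last t)).comp measurable_fst)
  obtain ⟨D, hD⟩ := exists_updateProd_le hf hdom z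
  -- The weight is `φ` of the evidence estimate. Since it is bounded uniformly in `M` and `φ` is
  -- continuous at the evidence, $L^1$ convergence is preserved.
  have hU : Tendsto (fun M => ∫⁻ p, ‖m.updateProd z p.1 - m.targetDensity z‖ₑ
      ∂m.ibisLaw K M z) atTop (𝓝 0) := by
    rw [ENNReal.tendsto_nhds_zero]
    intro ε hε
    -- As `ε` may be infinite, a finite `δ` is placed below it; one half is spent on continuity, the
    -- other on the convergence of the evidence estimate.
    obtain ⟨δ, hδ, hδε⟩ := ENNReal.lt_iff_exists_nnreal_btwn.1 hε
    have hδ' : (0 : ℝ) < δ := by exact_mod_cast hδ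
    obtain ⟨c, hc, hle⟩ := exists_abs_sub_le_add_mul hφ D (half_pos hδ')
    have hlim := ENNReal.Tendsto.const_mul (tendsto_lintegral_enorm_predProd_sub hf hK hz)
      (.inr (ENNReal.ofReal_ne_top (r := c)))
    rw [mul_zero, ENNReal.tendsto_nhds_zero] at hlim
    filter_upwards [hlim (ENNReal.ofReal (δ / 2)) (by simpa using hδ), eventually_ne_atTop 0]
      with M h1 hM
    have hmA : Measurable fun p : Part Θ M t => ‖m.predProd z p.1 - m.evidence z‖ₑ :=
      ((m.measurable_predProd.comp
        (measurable_const.prodMk measurable_fst)).sub_const _).enorm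
    calc _ ≤ ∫⁻ p, (ENNReal.ofReal (δ / 2) + ENNReal.ofReal c *
          ‖m.predProd z p.1 - m.evidence z‖ₑ) ∂m.ibisLaw K M z := by
          refine lintegral_mono fun p => ?_
          have := hle (m.predProd z p.1) (by
            change |m.policyProd z ^ m.η * m.predProd z p.1 ^ (1 - m.η)| ≤ D
            rw [← updateProd_eq hf hM, abs_of_nonneg (updateProd_nonneg hf hM _ _)]
            exact hD M p.1 hM)
          rw [Real.enorm_eq_ofReal_abs, Real.enorm_eq_ofReal_abs, ← ENNReal.ofReal_mul hc,
            ← ENNReal.ofReal_add (by positivity) (by positivity), updateProd_eq hf hM, htd]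
          exact ENNReal.ofReal_le_ofReal this
      _ ≤ ENNReal.ofReal (δ / 2) + ENNReal.ofReal (δ / 2) := by
          rw [lintegral_add_left measurable_const, lintegral_const_mul _ hmA, lintegral_const]
          exact add_le_add (mul_le_of_le_one_right' (m.ibisLaw_univ_le K z)) h1
      _ = δ := by
          rw [← ENNReal.ofReal_add (by positivity) (by positivity), add_halves,
            ENNReal.ofReal_coe_nnreal]
      _ ≤ ε := hδε.le
  have hlim := (ENNReal.Tendsto.const_mul hU (.inr (ENNReal.ofReal_ne_top (r := C)))).add
    (ENNReal.Tendsto.const_mul (tendsto_lintegral_enorm_pmean_sub hf hK hz hh hC')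
      (.inr (ENNReal.ofReal_ne_top (r := m.targetDensity z))))
  simp only [mul_zero, add_zero] at hlim
  rw [hμ', ← ENNReal.ofReal_mul htd0]
  have hmain := tendsto_lintegral_ofReal_of_enorm_sub (l := atTop)
    (μ := fun M => m.ibisLaw K M z) (c := m.targetDensity z * μ)
    (F := fun M (p : Part Θ M t) => m.updateProd z p.1 * pmean h (p.1 (Fin.last t)))
    ((eventually_ne_atTop 0).mono fun M hM => isProbabilityMeasure_ibisLaw hf hM hz)
    ((eventually_ne_atTop 0).mono fun M hM => (hmU M hM).mul (hmH M)) ?_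
  · refine hmain.congr' ?_
    filter_upwards [eventually_ne_atTop 0] with M hM
    refine lintegral_congr fun p => ?_
    rw [ENNReal.ofReal_mul (updateProd_nonneg hf hM _ _), ofReal_pmean h0 hM]
  · refine tendsto_of_tendsto_of_tendsto_of_le_of_le' tendsto_const_nhds hlim
      (Eventually.of_forall fun _ => zero_le) ?_
    filter_upwards [eventually_ne_atTop 0] with M hM
    rw [← lintegral_const_mul _ ((hmU M hM).sub_const _).enorm,
      ← lintegral_const_mul _ ((hmH M).sub_const _).enorm,
      ← lintegral_add_right _ (((hmH M).sub_const _).enorm.const_mul _)]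
    refine lintegral_mono fun p => enorm_mul_sub_mul_le ?_ (abs_of_nonneg htd0).le
    rw [abs_of_nonneg (pmean_nonneg h0 _)]
    obtain ⟨θ₀⟩ := m.prior.nonempty_of_neZero
    exact pmean_le ((h0 θ₀).trans (hC θ₀)) hC _

end Model

end SeqDesign

/-! ### Integration over histories and normalization -/

namespace SeqDesign

variable {X Ξ Θ : Type*} [MeasurableSpace X] [MeasurableSpace Ξ] [MeasurableSpace Θ]

namespace Model

variable (m : Model X Ξ Θ) (K : (s : ℕ) → Kernel (Hist X Ξ s × Θ) Θ) [∀ s, IsMarkovKernel (K s)]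

/-- The law of the particles and ancestors generated by IBIS, as a kernel. -/
noncomputable def ibisKernel (M t : ℕ) : Kernel (Hist X Ξ t) (Part Θ M t) :=
  ⟨m.ibisLaw K M, m.measurable_ibisLaw K t⟩

instance isFiniteKernel_ibisKernel (M t : ℕ) : IsFiniteKernel (m.ibisKernel K M t) :=
  ⟨1, ENNReal.one_lt_top, fun z => m.ibisLaw_univ_le K z⟩

/-- The unnormalized expectation of a function of `(z_{0:t}, θ_t)` under the law of all the
variables of the algorithm, conditionally on the history. -/
noncomputable def condExpect (M t : ℕ) (H : Hist X Ξ t × Θ → ENNReal) (z : Hist X Ξ t) : ENNReal :=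
  ∫⁻ p, ENNReal.ofReal (m.updateProd z p.1) * lmean (fun θ => H (z, θ)) (p.1 (Fin.last t))
    ∂m.ibisLaw K M z

variable {m K}

omit [∀ s, IsMarkovKernel (K s)] in
lemma measurable_lmean_comp {M t : ℕ} {H : Hist X Ξ t × Θ → ENNReal} (hH : Measurable H) :
    Measurable fun e : Hist X Ξ t × Part Θ M t =>
      lmean (fun θ => H (e.1, θ)) (e.2.1 (Fin.last t)) := by
  refine (Finset.measurable_sum _ fun i _ => hH.comp (measurable_fst.prodMk ?_)).const_mul _
  exact (measurable_pi_apply i).comp ((measurable_pi_apply (Fin.last t)).comp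
    (measurable_fst.comp measurable_snd))

lemma measurable_updateProd_comp (hf : m.PosBounded) {M t : ℕ} (hM : M ≠ 0) :
    Measurable fun e : Hist X Ξ t × Part Θ M t => m.updateProd e.1 e.2.1 :=
  (measurable_updateProd hf hM).comp
    (measurable_fst.prodMk (measurable_fst.comp measurable_snd))

lemma measurable_condExpect (hf : m.PosBounded) {M t : ℕ} (hM : M ≠ 0)
    {H : Hist X Ξ t × Θ → ENNReal} (hH : Measurable H) : Measurable (m.condExpect K M t H) :=
  Measurable.lintegral_kernel_prod_right (κ := m.ibisKernel K M t)
    (f := fun z p => ENNReal.ofReal (m.updateProd z p.1) *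
      lmean (fun θ => H (z, θ)) (p.1 (Fin.last t)))
    ((measurable_updateProd_comp hf hM).ennreal_ofReal.mul (measurable_lmean_comp hH))

lemma lintegral_smcUnnorm (hf : m.PosBounded) {M t : ℕ} (hM : M ≠ 0)
    {H : Hist X Ξ t × Θ → ENNReal} (hH : Measurable H) :
    ∫⁻ e, lmean (fun θ => H (e.1, θ)) (e.2.1 (Fin.last t)) ∂m.smcUnnorm K M t =
      ∫⁻ z, m.condExpect K M t H z ∂m.histRef t := by
  have hU := (measurable_updateProd_comp hf hM (t := t)).ennreal_ofReal
  have hL := measurable_lmean_comp (M := M) hH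
  have hk : Measurable fun z => (m.ibisLaw K M z).map (Prod.mk z) :=
    measurable_map_kernel (m.ibisKernel K M t) (F := fun z p => (z, p)) measurable_id
  rw [smcUnnorm, lintegral_withDensity_eq_lintegral_mul _ hU hL,
    Measure.lintegral_bind hk.aemeasurable (hU.mul hL).aemeasurable]
  refine lintegral_congr fun z => ?_
  rw [lintegral_map (hU.mul hL) measurable_prodMk_left]
  rfl

lemma smcUnnorm_univ (hf : m.PosBounded) {M t : ℕ} (hM : M ≠ 0) :
    m.smcUnnorm K M t Set.univ = ∫⁻ z, m.condExpect K M t (fun _ => 1) z ∂m.histRef t := by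
  rw [← lintegral_smcUnnorm hf hM measurable_const]
  simp [lmean_const hM]

omit [∀ s, IsMarkovKernel (K s)] in
lemma condExpect_one {M t : ℕ} (hM : M ≠ 0) (z : Hist X Ξ t) :
    m.condExpect K M t (fun _ => 1) z =
      ∫⁻ p, ENNReal.ofReal (m.updateProd z p.1) ∂m.ibisLaw K M z := by
  simp [condExpect, lmean_const hM]

/-- On the non-null set of histories with positive policy product, the IBIS law is a probability and
the weight is strictly positive. -/
lemma smcUnnorm_univ_ne_zero (hf : m.PosBounded) {M t : ℕ} (hM : M ≠ 0) :
    m.smcUnnorm K M t Set.univ ≠ 0 := by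
  rw [smcUnnorm_univ hf hM]
  intro h
  rw [lintegral_eq_zero_iff (measurable_condExpect hf hM measurable_const)] at h
  refine hf.not_ae_policyProd_eq_zero t (h.mono fun z hz => ?_)
  by_contra hne
  have hpos := (m.policyProd_nonneg z).lt_of_ne' hne
  have := isProbabilityMeasure_ibisLaw (K := K) hf hM hpos
  have hm : Measurable fun p : Part Θ M t => ENNReal.ofReal (m.updateProd z p.1) :=
    ((measurable_updateProd_comp hf hM).comp measurable_prodMk_left).ennreal_ofReal
  rw [condExpect_one hM, Pi.zero_apply, lintegral_eq_zero_iff hm] at hz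
  obtain ⟨p, hp⟩ := hz.exists
  exact (ENNReal.ofReal_pos.2 (updateProd_pos hf hM hpos p.1)).ne' hp

lemma smcUnnorm_univ_ne_top (hf : m.PosBounded) {M t : ℕ} (hM : M ≠ 0)
    (hK : m.InvariantUpTo K t) (hZ : m.targetZ t < ⊤) (hdom : 1 < m.η → m.Dominated t) :
    m.smcUnnorm K M t Set.univ ≠ ⊤ := by
  obtain ⟨G, hG, hle⟩ := exists_lintegral_updateProd_le hf hK hZ hdom
  rw [smcUnnorm_univ hf hM]
  refine ((lintegral_mono fun z => ?_).trans_lt hG).ne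
  rw [condExpect_one hM]
  exact hle M hM z

omit [∀ s, IsMarkovKernel (K s)] in
lemma lintegral_expEmpirical {M t : ℕ} {H : Hist X Ξ t × Θ → ENNReal} (hH : Measurable H) :
    ∫⁻ p, H p ∂m.expEmpirical K M t = (m.smcUnnorm K M t Set.univ)⁻¹ *
      ∫⁻ e, lmean (fun θ => H (e.1, θ)) (e.2.1 (Fin.last t)) ∂m.smcUnnorm K M t := by
  have hm : Measurable fun e : Hist X Ξ t × Part Θ M t =>
      (M : ENNReal)⁻¹ • ∑ i : Fin M, Measure.dirac (e.1, e.2.1 (Fin.last t) i) := by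
    refine Measure.measurable_of_measurable_coe _ fun s hs => ?_
    simp only [Measure.smul_apply, Measure.finsetSum_apply, smul_eq_mul]
    refine (Finset.measurable_sum _ fun i _ => (Measure.measurable_coe hs).comp
      (Measure.measurable_dirac.comp (measurable_fst.prodMk ?_))).const_mul _
    exact (measurable_pi_apply i).comp ((measurable_pi_apply (Fin.last t)).comp
      (measurable_fst.comp measurable_snd))
  rw [expEmpirical, Measure.lintegral_bind hm.aemeasurable hH.aemeasurable, smcLaw,
    lintegral_smul_measure, smul_eq_mul]
  congr 1
  refine lintegral_congr fun e => ?_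
  rw [lintegral_smul_measure, lintegral_finsetSum_measure, smul_eq_mul, lmean]
  simp only [lintegral_dirac' _ hH]

lemma isProbabilityMeasure_expEmpirical (hf : m.PosBounded) {M t : ℕ} (hM : M ≠ 0)
    (hK : m.InvariantUpTo K t) (hZ : m.targetZ t < ⊤) (hdom : 1 < m.η → m.Dominated t) :
    IsProbabilityMeasure (m.expEmpirical K M t) := by
  refine ⟨?_⟩
  rw [← lintegral_one, lintegral_expEmpirical measurable_const]
  simp only [lmean_const hM, lintegral_one]
  exact ENNReal.inv_mul_cancel (smcUnnorm_univ_ne_zero hf hM)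
    (smcUnnorm_univ_ne_top hf hM hK hZ hdom)

lemma measurable_targetDensity (hf : m.PosBounded) {t : ℕ} :
    Measurable (m.targetDensity : Hist X Ξ t → ℝ) := by
  rw [show (m.targetDensity : Hist X Ξ t → ℝ) = _ from funext hf.targetDensity_eq]
  exact (m.measurable_policyProd.pow_const _).mul (m.measurable_evidence.pow_const _)

lemma targetDensity_eq_zero (hf : m.PosBounded) {t : ℕ} {z : Hist X Ξ t}
    (hz : m.policyProd z = 0) : m.targetDensity z = 0 := by
  rw [hf.targetDensity_eq, hz, Real.zero_rpow m.η_pos.ne', zero_mul]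

lemma targetZ_ne_zero (hf : m.PosBounded) (t : ℕ) : m.targetZ t ≠ 0 := by
  rw [targetZ]
  intro h
  rw [lintegral_eq_zero_iff (measurable_targetDensity hf).ennreal_ofReal] at h
  refine hf.not_ae_policyProd_eq_zero t (h.mono fun z hz => ?_)
  by_contra hne
  have hpos := (m.policyProd_nonneg z).lt_of_ne' hne
  have : 0 < m.targetDensity z := by
    rw [hf.targetDensity_eq]
    exact mul_pos (Real.rpow_pos_of_pos hpos _) (Real.rpow_pos_of_pos (hf.evidence_pos hpos) _)
  exact (ENNReal.ofReal_pos.2 this).ne' hz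

lemma lintegral_target (hf : m.PosBounded) {t : ℕ} {H : Hist X Ξ t × Θ → ENNReal}
    (hH : Measurable H) : ∫⁻ p, H p ∂m.target t = (m.targetZ t)⁻¹ *
      ∫⁻ z, ENNReal.ofReal (m.targetDensity z) * ∫⁻ θ, H (z, θ) ∂m.posterior z ∂m.histRef t := by
  have hd : Measurable fun p : Hist X Ξ t × Θ =>
      ENNReal.ofReal (m.targetDensity p.1) * ENNReal.ofReal (m.postDensity p.1 p.2) :=
    ((measurable_targetDensity hf).comp measurable_fst).ennreal_ofReal.mul
      m.measurable_postDensity.ennreal_ofReal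
  rw [target, lintegral_smul_measure, smul_eq_mul, lintegral_withDensity_eq_lintegral_mul _ hd hH,
    lintegral_prod _ (hd.mul hH).aemeasurable]
  congr 1
  refine lintegral_congr fun z => ?_
  have hz : Measurable fun θ => H (z, θ) := hH.comp measurable_prodMk_left
  have hp : Measurable fun θ => m.postDensity z θ :=
    m.measurable_postDensity.comp measurable_prodMk_left
  rw [m.lintegral_posterior z hz,
    ← lintegral_const_mul (f := fun θ => ENNReal.ofReal (m.postDensity z θ) * H (z, θ)) _
      (hp.ennreal_ofReal.mul hz)]
  simp only [Pi.mul_apply, mul_assoc]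

/-- The posterior may fail to be a probability only where the policy product is zero, and there the
target density is zero too. -/
lemma lintegral_targetDensity_mul_posterior_univ (hf : m.PosBounded) (t : ℕ) :
    ∫⁻ z : Hist X Ξ t, ENNReal.ofReal (m.targetDensity z) * ∫⁻ _, 1 ∂m.posterior z ∂m.histRef t =
      m.targetZ t := by
  refine lintegral_congr fun z => ?_
  rcases (m.policyProd_nonneg z).eq_or_lt with hz | hz
  · simp [targetDensity_eq_zero hf hz.symm]
  · have := hf.isProbabilityMeasure_posterior hz
    simp

lemma isProbabilityMeasure_target (hf : m.PosBounded) {t : ℕ} (hZ : m.targetZ t < ⊤) :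
    IsProbabilityMeasure (m.target t) := by
  refine ⟨?_⟩
  rw [← lintegral_one, lintegral_target hf measurable_const,
    lintegral_targetDensity_mul_posterior_univ hf]
  exact ENNReal.inv_mul_cancel (targetZ_ne_zero hf t) hZ.ne

/-- Dominated convergence over histories: the pointwise limit holds at every history, and `C` times
the bound on the mean weight dominates for every nonzero `M`. -/
lemma tendsto_lintegral_condExpect (hf : m.PosBounded) {t : ℕ} (hK : m.InvariantUpTo K t)
    (hZ : m.targetZ t < ⊤) (hdom : 1 < m.η → m.Dominated t) {h : Hist X Ξ t × Θ → ℝ}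
    (hh : Measurable h) (h0 : ∀ p, 0 ≤ h p) {C : ℝ} (hC : ∀ p, h p ≤ C) :
    Tendsto (fun M => ∫⁻ z, m.condExpect K M t (fun p => ENNReal.ofReal (h p)) z ∂m.histRef t)
      atTop (𝓝 (∫⁻ z, ENNReal.ofReal (m.targetDensity z) *
        ∫⁻ θ, ENNReal.ofReal (h (z, θ)) ∂m.posterior z ∂m.histRef t)) := by
  obtain ⟨G, hG, hle⟩ := exists_lintegral_updateProd_le hf hK hZ hdom
  refine tendsto_lintegral_filter_of_dominated_convergence
    (fun z => ENNReal.ofReal C * G z) ?_ ?_ ?_ ?_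
  · filter_upwards [eventually_ne_atTop 0] with M hM
    exact measurable_condExpect hf hM hh.ennreal_ofReal
  · filter_upwards [eventually_ne_atTop 0] with M hM
    refine ae_of_all _ fun z => ?_
    have hm : Measurable fun p : Part Θ M t => ENNReal.ofReal (m.updateProd z p.1) :=
      ((measurable_updateProd_comp hf hM).comp measurable_prodMk_left).ennreal_ofReal
    calc _ ≤ ∫⁻ p, ENNReal.ofReal C * ENNReal.ofReal (m.updateProd z p.1) ∂m.ibisLaw K M z := by
          refine lintegral_mono fun p => ?_
          rw [mul_comm]
          gcongr
          calc _ ≤ lmean (fun _ => ENNReal.ofReal C) (p.1 (Fin.last t)) := by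
                unfold lmean
                gcongr
                exact ENNReal.ofReal_le_ofReal (hC _)
            _ = _ := lmean_const hM _ _
      _ ≤ _ := by
          rw [lintegral_const_mul _ hm]
          gcongr
          exact hle M hM z
  · rw [lintegral_const_mul' _ _ ENNReal.ofReal_ne_top]
    exact ENNReal.mul_ne_top ENNReal.ofReal_ne_top hG.ne
  · exact ae_of_all _ fun z => tendsto_lintegral_updateProd_mul_lmean hf hK hdom z
      (h := fun θ => h (z, θ)) (hh.comp measurable_prodMk_left) (fun _ => h0 _) fun _ => hC _

lemma tendsto_lintegral_expEmpirical (hf : m.PosBounded) {t : ℕ} (hK : m.InvariantUpTo K t)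
    (hZ : m.targetZ t < ⊤) (hdom : 1 < m.η → m.Dominated t) {h : Hist X Ξ t × Θ → ℝ}
    (hh : Measurable h) (h0 : ∀ p, 0 ≤ h p) {C : ℝ} (hC : ∀ p, h p ≤ C) :
    Tendsto (fun M => ∫⁻ p, ENNReal.ofReal (h p) ∂m.expEmpirical K M t) atTop
      (𝓝 (∫⁻ p, ENNReal.ofReal (h p) ∂m.target t)) := by
  have h1 := tendsto_lintegral_condExpect hf hK hZ hdom hh h0 hC
  have h2 := tendsto_lintegral_condExpect hf hK hZ hdom (h := fun _ => 1) measurable_const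
    (fun _ => zero_le_one) (fun _ => le_rfl)
  simp only [ENNReal.ofReal_one] at h2
  rw [lintegral_targetDensity_mul_posterior_univ hf] at h2
  -- Both laws are quotients of unnormalized integrals; the case of the constant 1 supplies the
  -- denominators. The form `0 * ⊤` is excluded since `Z_t` is nonzero and the numerator has a
  -- finite limit.
  have h3 := ENNReal.Tendsto.mul (tendsto_inv_iff.2 h2)
    (.inr ?_) h1 (.inr (ENNReal.inv_ne_top.2 (targetZ_ne_zero hf t)))
  · rw [lintegral_target hf hh.ennreal_ofReal]
    refine h3.congr' ?_
    filter_upwards [eventually_ne_atTop 0] with M hM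
    rw [lintegral_expEmpirical hh.ennreal_ofReal, lintegral_smcUnnorm hf hM hh.ennreal_ofReal,
      smcUnnorm_univ hf hM]
  · have := isProbabilityMeasure_target hf hZ
    have hfin : ∫⁻ p, ENNReal.ofReal (h p) ∂m.target t ≠ ⊤ := by
      refine ((lintegral_mono fun p => ENNReal.ofReal_le_ofReal (hC p)).trans_lt ?_).ne
      simp
    rw [lintegral_target hf hh.ennreal_ofReal] at hfin
    intro htop
    rw [htop, ENNReal.mul_top (ENNReal.inv_ne_zero.2 hZ.ne)] at hfin
    exact hfin rfl

end Model

end SeqDesign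

/-! ### The consistency theorem for bounded test functions -/

theorem proposition2 {X Ξ Θ : Type*} [MeasurableSpace X] [MeasurableSpace Ξ] [MeasurableSpace Θ]
    (m : SeqDesign.Model X Ξ Θ)
    (K : (s : ℕ) → Kernel (SeqDesign.Hist X Ξ s × Θ) Θ) [∀ s, IsMarkovKernel (K s)]
    (t : ℕ)
    (hK : ∀ s, 1 ≤ s → s ≤ t → ∀ z : SeqDesign.Hist X Ξ s,
      Kernel.Invariant ((K s).sectR z) (m.posterior z))
    (hf : ∀ (x : X) (ξ : Ξ) (x' : X), ∃ α : ℝ, 0 < α ∧ ∀ θ, 0 < m.f x ξ x' θ ∧ m.f x ξ x' θ < α)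
    (hp : ∀ s, 1 ≤ s → s < t → ∀ z : SeqDesign.Hist X Ξ s, ∃ β : X × Ξ → ℝ,
      Integrable β m.lamZ ∧ ∀ z' θ, 0 < m.trans z z' θ ∧ m.trans z z' θ < β z')
    (hZ : m.targetZ t < ⊤)
    (hdom : 1 < m.η → ∃ B : SeqDesign.Hist X Ξ t → ℝ,
      Integrable B (m.histRef t) ∧ ∀ z θ, m.weightedDensity z θ ≤ B z) :
    IsProbabilityMeasure (m.target t) ∧
    (∀ M, 1 ≤ M → IsProbabilityMeasure (m.expEmpirical K M t)) ∧
    ∀ ψ : SeqDesign.Hist X Ξ t × Θ → ℝ, Measurable ψ → (∃ C, ∀ p, |ψ p| ≤ C) →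
      Tendsto (fun M => ∫ p, ψ p ∂(m.expEmpirical K M t)) atTop (𝓝 (∫ p, ψ p ∂(m.target t))) := by
  have hT := SeqDesign.Model.isProbabilityMeasure_target (m := m) hf hZ
  have hE : ∀ M, 1 ≤ M → IsProbabilityMeasure (m.expEmpirical K M t) := fun M hM =>
    SeqDesign.Model.isProbabilityMeasure_expEmpirical hf (Nat.one_le_iff_ne_zero.1 hM) hK hZ hdom
  refine ⟨hT, hE, ?_⟩
  rintro ψ hψ ⟨C, hC⟩
  -- The shifted function takes values between `0` and `C + C`; the shift is removed at the end
  -- since all the measures involved have mass one.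
  have hlim := SeqDesign.Model.tendsto_lintegral_expEmpirical (K := K) hf hK hZ hdom
    (h := fun p => ψ p + C) (hψ.add_const C) (fun p => by linarith [(abs_le.1 (hC p)).1])
    (C := C + C) (fun p => by linarith [(abs_le.1 (hC p)).2])
  have hfin : ∫⁻ p, ENNReal.ofReal (ψ p + C) ∂m.target t ≠ ⊤ := by
    refine ((lintegral_mono fun p => ENNReal.ofReal_le_ofReal (?_ : ψ p + C ≤ C + C)).trans_lt
      ?_).ne
    · linarith [(abs_le.1 (hC p)).2]
    · simp
  rw [SeqDesign.integral_eq_toReal_lintegral_sub _ hψ hC]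
  refine (((ENNReal.tendsto_toReal hfin).comp hlim).sub_const C).congr' ?_
  filter_upwards [eventually_ge_atTop 1] with M hM
  have := hE M hM
  rw [SeqDesign.integral_eq_toReal_lintegral_sub _ hψ hC]
  rfl
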